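/- Let $K$ be an algebraically closed field of characteristic $0$, let $\Lambda$ be an algebraic variety over $K$ (a reduced separated scheme of finite type, not necessarily irreducible), identified with its set of $K$-points with the Zariski topology, and let $d\ge 2$. Let $P:\Lambda\times\mathbb A^1\to\Lambda\times\mathbb A^1$, $P(\lambda,z)=(\lambda,P_\lambda(z))$, be an algebraic family of polynomials of degree $d$: the coefficients of $P_\lambda$ are regular functions of $\lambda$ and $\deg P_\lambda=d$ for every $\lambda$. Put $$\mathrm{Preper}=\{(\lambda,z)\in\Lambda\times\mathbb A^1:\ \{P_\lambda^n(z)\}_{n\ge1}\text{ is finite}\}.$$ Let $(\lambda_0,z_0)\in\Lambda\times\mathbb A^1$ be a point that belongs to every member of an infinite sequence $(Z_i)_{i\ge0}$ of pairwise distinct irreducible hypersurfaces (irreducible closed subsets of codimension $1$) of $\Lambda\times\mathbb A^1$ contained in $\mathrm{Preper}$. Then there exist - a base change, that is, a finite surjective morphism $\pi:\Lambda'\to\Lambda$ of varieties mapping each irreducible component of $\Lambda'$ onto an irreducible component of $\Lambda$, and a point $\lambda_0'\in\Lambda'$ with $\pi(\lambda_0')=\lambda_0$; - integers $N\ge1$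 and $k\ge0$, with $k=0$ if $z_0$ is periodic for $P_{\lambda_0}$; - a family of affine transformations $\varphi_{\lambda'}(z)=a(\lambda')z+b(\lambda')$, where $a,b$ are regular functions on $\Lambda'$ and $a$ vanishes nowhere; such that the conjugated family $R_{\lambda'}=\varphi_{\lambda'}\circ P^N_{\pi(\lambda')}\circ\varphi_{\lambda'}^{-1}$, parameterized by $\Lambda'$, and the point $c=\varphi_{\lambda_0'}\bigl(P_{\lambda_0}^{Nk}(z_0)\bigr)\in K$ (so $c=\varphi_{\lambda_0'}(z_0)$ if $z_0$ is periodic) have the following properties. 1. $R_{\lambda'}(c)=c$ for every $\lambda'\in\Lambda'$; moreover $R_{\lambda_0'}'(c)=0$, i.e. $c$ is super-attracting for $R_{\lambda_0'}$, and the local degree function $\lambda'\mapsto\operatorname{ord}_c(R_{\lambda'})$ (the order of vanishing of $R_{\lambda'}(z)-R_{\lambda'}(c)$ at $z=c$) is not locally constant near $\lambda_0'$. 2. There is a sequence of integers $n_i\to\infty$ such that, for every $i$, each irreducible component of the transform $\{(\lambda',\varphi_{\lambda'}(z)):(\pi(\lambda'),z)\in Z_i\}$ of $Z_i$ that contains $(\lambda_0',\varphi_{\lambda_0'}(z_0))$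 is an irreducible component of $\{(\lambda',z)\in\Lambda'\times\mathbb A^1:\ R_{\lambda'}^{n_i}(z)=c\}$. -/

import Mathlib

open AlgebraicGeometry CategoryTheory Polynomial

universe u

namespace PolyFamily

/-- The `K`-points of the `K`-scheme `s : Λ ⟶ Spec K`. -/
def Pt {K : Type u} [Field K] {Λ : Scheme.{u}} (s : Λ ⟶ Spec (.of K)) : Type u :=
  {x : Spec (.of K) ⟶ Λ // x ≫ s = 𝟙 (Spec (.of K))}

/-- The Zariski topology on the `K`-points: the topology induced by that of the scheme. -/
noncomputable instance {K : Type u} [Field K] {Λ : Scheme.{u}} (s : Λ ⟶ Spec (.of K)) :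
    TopologicalSpace (Pt s) :=
  TopologicalSpace.induced (fun x => (x.1 (IsLocalRing.closedPoint K) : Λ)) inferInstance

/-- The map on `K`-points induced by a morphism `π : Λ' ⟶ Λ`. -/
noncomputable def Pt.map {K : Type u} [Field K] {Λ Λ' : Scheme.{u}} (s : Λ ⟶ Spec (.of K)) (π : Λ' ⟶ Λ)
    (x : Pt (π ≫ s)) : Pt s :=
  ⟨x.1 ≫ π, by rw [Category.assoc]; exact x.2⟩

/-- The value at a `K`-point of a regular function on `Λ`, as a ring homomorphism. -/
noncomputable def Pt.value {K : Type u} [Field K] {Λ : Scheme.{u}} {s : Λ ⟶ Spec (.of K)}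
    (x : Pt s) : Γ(Λ, ⊤) →+* K :=
  (Scheme.ΓSpecIso (.of K)).hom.hom.comp x.1.appTop.hom

/-- The `K`-points `(lam, z)` of `Λ × 𝔸¹`. -/
@[ext]
structure LinePt {K : Type u} [Field K] {Λ : Scheme.{u}} (s : Λ ⟶ Spec (.of K)) : Type u where
  lam : Pt s
  z : K

/-- The point of the scheme `𝔸¹_Λ = Λ × 𝔸¹` defined by a pair `(lam, z)`. -/
noncomputable def LinePt.toScheme {K : Type u} [Field K] {Λ : Scheme.{u}}
    {s : Λ ⟶ Spec (.of K)} (p : LinePt s) : 𝔸(PUnit.{u + 1}; Λ) :=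
  (AffineSpace.homOfVector p.lam.1
    (fun _ : PUnit.{u + 1} => (Scheme.ΓSpecIso (.of K)).inv.hom p.z))
    (IsLocalRing.closedPoint K)

/-- The Zariski topology on the `K`-points of `Λ × 𝔸¹`, induced by that of the scheme `𝔸¹_Λ`. -/
noncomputable instance {K : Type u} [Field K] {Λ : Scheme.{u}} (s : Λ ⟶ Spec (.of K)) :
    TopologicalSpace (LinePt s) :=
  TopologicalSpace.induced LinePt.toScheme inferInstance

/-- The member `P_lam ∈ K[z]` of the family of polynomials `P` with coefficients in the ring of
regular functions on `Λ`. -/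
noncomputable def fiber {K : Type u} [Field K] {Λ : Scheme.{u}} {s : Λ ⟶ Spec (.of K)}
    (P : Γ(Λ, ⊤)[X]) (x : Pt s) : K[X] :=
  P.map x.value

/-- `P` is an algebraic family of polynomials of degree `d`: the regular map
`(lam, z) ↦ (lam, P_lam(z))` of `Λ × 𝔸¹` is given by a polynomial with coefficients regular
functions on `Λ`, and each `P_lam` has degree exactly `d`. -/
def IsFamilyOfDegree {K : Type u} [Field K] {Λ : Scheme.{u}} (s : Λ ⟶ Spec (.of K))
    (d : ℕ) (P : Γ(Λ, ⊤)[X]) : Prop :=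
  ∀ x : Pt s, (fiber P x).degree = d

/-- The preperiodic locus: the pairs `(lam, z)` such that `{P_lam^n(z) : n ≥ 1}` is finite. -/
def preper {K : Type u} [Field K] {Λ : Scheme.{u}} (s : Λ ⟶ Spec (.of K))
    (P : Γ(Λ, ⊤)[X]) : Set (LinePt s) :=
  {p | {w : K | ∃ n : ℕ, 1 ≤ n ∧ w = (fun t => (fiber P p.lam).eval t)^[n] p.z}.Finite}

/-- The locus `{(lam, z) : P_lam^n(z) = c}`. -/
def preimageLocus {K : Type u} [Field K] {Λ : Scheme.{u}} (s : Λ ⟶ Spec (.of K))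
    (P : Γ(Λ, ⊤)[X]) (n : ℕ) (c : K) : Set (LinePt s) :=
  {p | (fun t => (fiber P p.lam).eval t)^[n] p.z = c}

/-- `Z` is an irreducible component of the subset `S` of a topological space: a maximal
irreducible subset of `S`. -/
def IsComponentOf {T : Type*} [TopologicalSpace T] (S Z : Set T) : Prop :=
  Maximal (fun Y : Set T => IsIrreducible Y ∧ Y ⊆ S) Z

/-- The `N`-th iterate (for composition) of a polynomial. -/
noncomputable def iter {A : Type*} [CommRing A] (P : A[X]) (N : ℕ) : A[X] :=
  (fun Q : A[X] => P.comp Q)^[N] X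

/-- The affine transformation `z ↦ a z + b`, as a polynomial. -/
noncomputable def affine {A : Type*} [CommRing A] (a : Aˣ) (b : A) : A[X] :=
  C (a : A) * X + C b

/-- The local degree at `c` of a polynomial: the order of vanishing of `p(z) - p(c)` at `c`. -/
noncomputable def localDegree {K : Type*} [Field K] (p : K[X]) (c : K) : ℕ :=
  (p - C (p.eval c)).rootMultiplicity c

/-- The transform of `Z ⊆ Λ × 𝔸¹` under the base change `π : Λ' ⟶ Λ` followed by the change of
coordinates `(lam', z) ↦ (lam', φ_lam'(z))` on `Λ' × 𝔸¹`. -/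
def transform {K : Type u} [Field K] {Λ Λ' : Scheme.{u}} (s : Λ ⟶ Spec (.of K)) (π : Λ' ⟶ Λ)
    (φ : Γ(Λ', ⊤)[X]) (Z : Set (LinePt s)) : Set (LinePt (π ≫ s)) :=
  {p | ∃ z : K, (⟨p.lam.map s π, z⟩ : LinePt s) ∈ Z ∧ p.z = (fiber φ p.lam).eval z}

end PolyFamily

/-!
The proof rests on three facts.

*Uniform preperiodicity.* On an irreducible closed set `Z ⊆ Preper` there are `a < b` with
`P^a = P^b` on all of `Z` (`exists_iterate_eq_of_subset_preper`). Let `B` be the coordinate ring of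
an affine chart of `Z` and choose on `K` a nontrivial valuation, which exists because the
characteristic is zero. A point of large absolute value escapes to infinity, so the orbit of a
preperiodic point is bounded in terms of the coefficients of the polynomial. Hence the iterates
`P^n(z)`, as elements of `B`, are all of the same polynomial growth. By Noether normalization the
elements of `B` of a given growth are determined by their values at finitely many `K`-points
(`exists_finite_separating`), and there every orbit takes finitely many values. By pigeonhole two
iterates coincide in `B` (`exists_iterate_eq_of_forall_algHom`).

*Local dynamics.* Fix `N` and `k` such that `c₀ = P^{Nk}(z₀)` is fixed by `P^N` at `λ₀`, with
multiplier `μ` equal to `1` or not a root of unity (`exists_iterate_sum_pow_ne_zero`). Let `B` be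
the domain of functions on an irreducible set through the base point and `ε : B → K` the evaluation
there. For `x, y ∈ B` specializing to `c₀`, the difference `P^{Nn}(x) - P^{Nn}(y)` is
`(x - y) * e` with `ε e = μ^n` (`exists_iterate_sub_eq`). Since `B` is a domain this gives:
periodic `x` are fixed; if `μ ≠ 1` there is at most one fixed `x`; if `μ ≠ 0` iterates are
injective. So on every hypersurface `Z_i` one has `P^{N(n+1)} = P^{Nn}` for large `n`
(`subset_coincidence_of_iterate_eq`), and if `μ` were nonzero this would hold on every `Z_i` with
`n = k`.

*Finiteness.* The locus `{P^a = P^b}`, `a ≠ b`, is closed with empty interior, so the hypersurfaces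
contained in it are among its finitely many components (`exists_not_subset_coincidence`). Hence
`μ = 0`.

A finite, open, surjective base change `π` turns `c₀` into a regular function `c` on `Λ'` with
`P^N(c) = c` (`exists_baseChange_of_monic`), and `R(y) = P^N(y + c) - c` fixes `0`. As `μ = 0 ≠ 1`,
`0` is the only fixed point of `R` near the base point, so a component `Z'` of the transform of
`Z_i` lies in `{R^n = 0}` for large `n`. Any larger irreducible subset of `{R^n = 0}` has image in
`{P^{N(n+1)} = P^{Nn}}`, of which `Z_i` is a component, whence `Z'` is a component of `{R^n = 0}`
(`isComponentOf_preimageLocus`). Finally, if the local degree `e` of `R` at `0` were locally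
constant, then `R(y) = y^e * g(y)` with `g(0) ≠ 0` at the base point, and `R^n = 0` on `Z'` would
force `R^k = 0` on `Z'` and `P^{N(k+1)} = P^{Nk}` on every `Z_i`, against finiteness
(`not_eventually_localDegree_eq`).
-/

namespace PolyFamily

/-! ### Valuations and values of polynomials -/

/-- A field of characteristic zero carries a valuation that is nontrivial on the integers,
extending the `2`-adic one. -/
theorem exists_valuationSubring_one_lt (K : Type*) [Field K] [CharZero K] :
    ∃ V : ValuationSubring K, ∃ x : K, 1 < V.valuation x := by
  let A : Subring K := (Int.castRingHom K).range
  let two : A := ⟨2, 2, by simp⟩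
  have hI : Ideal.span {two} ≠ ⊤ := by
    rw [Ne, Ideal.span_singleton_eq_top]
    intro h
    obtain ⟨⟨y, n, hn⟩, hy⟩ := isUnit_iff_exists_inv.mp h
    have h1 : (2 : K) * (n : K) = 1 := by
      have := congrArg Subtype.val hy
      simp only [Subring.coe_mul, Subring.coe_one] at this
      rw [← this, ← hn]; rfl
    have h2 : (2 * n : ℤ) = 1 := by exact_mod_cast h1
    omega
  obtain ⟨V, -, hV⟩ := Ideal.image_subset_nonunits_valuationSubring _ hI
  have h2 : (2 : K) ∈ V.nonunits :=
    hV ⟨two, Ideal.subset_span rfl, rfl⟩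
  refine ⟨V, 2⁻¹, ?_⟩
  rw [map_inv₀]
  exact (one_lt_inv₀ (by simp [zero_lt_iff])).mpr (V.mem_nonunits_iff.mp h2)

section Valuation

variable {K Γ₀ : Type*} [Field K] [LinearOrderedCommGroupWithZero Γ₀] (v : Valuation K Γ₀)

/-- Far from the origin, the leading term of a polynomial dominates. -/
theorem valuation_eval_of_lt (p : K[X]) {Y : Γ₀} (hY : 1 ≤ Y)
    (hp : ∀ j, v (p.coeff j) ≤ Y * v p.leadingCoeff) {x : K} (hx : Y < v x) :
    v (p.eval x) = v p.leadingCoeff * v x ^ p.natDegree := by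
  by_cases h0 : p = 0
  · simp [h0]
  have hlc : 0 < v p.leadingCoeff := by simp [zero_lt_iff, h0]
  have hx1 : 1 < v x := hY.trans_lt hx
  have hx0 : 0 < v x := zero_lt_one.trans hx1
  have htop : v (p.leadingCoeff * x ^ p.natDegree) = v p.leadingCoeff * v x ^ p.natDegree := by
    simp
  rw [eval_eq_sum_range, Finset.sum_range_succ, coeff_natDegree, ← htop]
  refine Valuation.map_add_eq_of_lt_right v ?_
  rw [htop]
  refine v.map_sum_lt (mul_pos hlc (pow_pos hx0 _)).ne' fun j hj => ?_
  rw [map_mul, map_pow]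
  have hj' : j + 1 ≤ p.natDegree := Finset.mem_range.mp hj
  calc v (p.coeff j) * v x ^ j ≤ (Y * v p.leadingCoeff) * v x ^ j := by gcongr; exact hp j
    _ = (v p.leadingCoeff * v x ^ j) * Y := by ac_rfl
    _ < (v p.leadingCoeff * v x ^ j) * v x := by
        exact mul_lt_mul_of_pos_left hx (mul_pos hlc (pow_pos hx0 _))
    _ = v p.leadingCoeff * v x ^ (j + 1) := by rw [pow_succ, mul_assoc]
    _ ≤ v p.leadingCoeff * v x ^ p.natDegree := by
        gcongr; exact hx1.le

theorem valuation_root_le (p : K[X]) (hp : p.Monic) {Y : Γ₀} (hY : 1 ≤ Y)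
    (hc : ∀ j, v (p.coeff j) ≤ Y) {x : K} (hx : p.eval x = 0) : v x ≤ Y := by
  by_contra! h
  have := valuation_eval_of_lt v p hY (by simpa [hp.leadingCoeff] using hc) h
  rw [hx, hp.leadingCoeff, map_zero, map_one, one_mul] at this
  exact pow_ne_zero _ (zero_lt_one.trans (hY.trans_lt h)).ne' this.symm

/-- Points of large absolute value escape to infinity. -/
theorem valuation_lt_valuation_eval (p : K[X]) (hd : 2 ≤ p.natDegree) {Y : Γ₀} (hY : 1 ≤ Y)
    (hl : v p.leadingCoeff⁻¹ ≤ Y) (hp : ∀ j, v (p.coeff j * p.leadingCoeff⁻¹) ≤ Y)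
    {x : K} (hx : Y < v x) : v x < v (p.eval x) := by
  have h0 : p ≠ 0 := by rintro rfl; simp at hd
  have hlc : 0 < v p.leadingCoeff := by simp [zero_lt_iff, h0]
  have hx1 : 1 < v x := hY.trans_lt hx
  have hx0 : 0 < v x := zero_lt_one.trans hx1
  rw [valuation_eval_of_lt v p hY (fun j => ?_) hx]
  · have h1 : 1 < v p.leadingCoeff * v x := by
      rw [map_inv₀] at hl
      rw [← inv_lt_iff_one_lt_mul₀' hlc]
      exact hl.trans_lt hx
    calc v x = 1 * v x := (one_mul _).symm
      _ < (v p.leadingCoeff * v x) * v x := mul_lt_mul_of_pos_right h1 hx0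
      _ = v p.leadingCoeff * v x ^ 2 := by rw [mul_assoc, sq]
      _ ≤ _ := by gcongr; exact hx1.le
  · have := hp j
    rw [map_mul, map_inv₀] at this
    rwa [← div_eq_mul_inv, div_le_iff₀ hlc] at this

theorem valuation_iterate_le_of_finite (p : K[X]) (hd : 2 ≤ p.natDegree) {Y : Γ₀} (hY : 1 ≤ Y)
    (hl : v p.leadingCoeff⁻¹ ≤ Y) (hp : ∀ j, v (p.coeff j * p.leadingCoeff⁻¹) ≤ Y)
    {z : K} (hz : {w : K | ∃ n : ℕ, 1 ≤ n ∧ w = (fun t => p.eval t)^[n] z}.Finite)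
    {n : ℕ} (hn : 1 ≤ n) : v ((fun t => p.eval t)^[n] z) ≤ Y := by
  by_contra! h
  set F : K → K := fun t => p.eval t
  have hbig : ∀ m, Y < v (F^[m] (F^[n] z)) := by
    intro m
    induction m with
    | zero => exact h
    | succ m ih =>
      rw [Function.iterate_succ_apply']
      exact ih.trans (valuation_lt_valuation_eval v p hd hY hl hp ih)
  have hmono : StrictMono fun m => v (F^[m] (F^[n] z)) := by
    refine strictMono_nat_of_lt_succ fun m => ?_
    rw [Function.iterate_succ_apply']
    exact valuation_lt_valuation_eval v p hd hY hl hp (hbig m)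
  refine Set.infinite_of_injective_forall_mem
    (f := fun m => F^[m] (F^[n] z)) (fun a b hab => hmono.injective (congrArg v hab)) ?_ hz
  intro m
  exact ⟨m + n, by omega, by rw [Function.iterate_add_apply]⟩

theorem exists_valuation_coeff_le (p : K[X]) : ∃ Y : Γ₀, 1 ≤ Y ∧ ∀ j, v (p.coeff j) ≤ Y := by
  obtain ⟨Y, hY⟩ := Finset.exists_le (insert 1 ((Finset.range (p.natDegree + 1)).image
    fun j => v (p.coeff j)))
  have h1 : 1 ≤ Y := hY _ (Finset.mem_insert_self _ _)
  refine ⟨Y, h1, fun j => ?_⟩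
  by_cases hj : j < p.natDegree + 1
  · exact hY _ (Finset.mem_insert_of_mem (Finset.mem_image_of_mem _ (Finset.mem_range.mpr hj)))
  · rw [coeff_eq_zero_of_natDegree_lt (by omega), map_zero]
    exact zero_le

/-- A polynomial in one variable whose values grow at most like `|x| ^ M` has degree at
most `M`. -/
theorem natDegree_le_of_valuation_eval_le (hv : Function.Surjective v) (h1 : ∃ x, 1 < v x)
    (p : K[X]) {C : Γ₀} {M : ℕ} (h : ∀ x, 1 ≤ v x → v (p.eval x) ≤ C * v x ^ M) :
    p.natDegree ≤ M := by
  by_contra! hM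
  have h0 : p ≠ 0 := by rintro rfl; simp at hM
  have hlc : 0 < v p.leadingCoeff := by simp [zero_lt_iff, h0]
  obtain ⟨Y, hY1, hY⟩ := exists_valuation_coeff_le v p
  -- an element larger than all ratios of coefficients and than `C / |leading coefficient|`
  obtain ⟨Y', hY'⟩ := Finset.exists_le {1, Y / v p.leadingCoeff, C / v p.leadingCoeff}
  have hY'1 : 1 ≤ Y' := hY' _ (by simp)
  have hY'2 : Y / v p.leadingCoeff ≤ Y' := hY' _ (by simp)
  have hY'3 : C / v p.leadingCoeff ≤ Y' := hY' _ (by simp)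
  obtain ⟨a, rfl⟩ := hv Y'
  obtain ⟨r, hr⟩ := h1
  have hx : v a < v (a * r) := by
    rw [map_mul]
    exact lt_mul_of_one_lt_right (zero_lt_one.trans_le hY'1) hr
  have hx1 : 1 < v (a * r) := hY'1.trans_lt hx
  have hx0 : 0 < v (a * r) := zero_lt_one.trans hx1
  have key := h (a * r) hx1.le
  rw [valuation_eval_of_lt v p hY'1 (fun j => (hY j).trans ((div_le_iff₀ hlc).mp hY'2)) hx] at key
  refine absurd key (not_le_of_gt ?_)
  calc C * v (a * r) ^ M ≤ (v a * v p.leadingCoeff) * v (a * r) ^ M := by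
        gcongr; exact (div_le_iff₀ hlc).mp hY'3
    _ = (v p.leadingCoeff * v (a * r) ^ M) * v a := by ac_rfl
    _ < (v p.leadingCoeff * v (a * r) ^ M) * v (a * r) :=
        mul_lt_mul_of_pos_left hx (mul_pos hlc (pow_pos hx0 _))
    _ = v p.leadingCoeff * v (a * r) ^ (M + 1) := by rw [pow_succ, mul_assoc]
    _ ≤ _ := by gcongr; exacts [hx1.le, hM]

/-- The restriction of a polynomial in several variables to the line spanned by `y`. -/
theorem coeff_aeval_C_mul_X {σ : Type*} (g : MvPolynomial σ K) (y : σ → K) (e : ℕ) :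
    (MvPolynomial.aeval (fun i => C (y i) * (X : K[X])) g).coeff e =
      MvPolynomial.eval y (MvPolynomial.homogeneousComponent e g) := by
  induction g using MvPolynomial.induction_on' with
  | add p q hp hq => simp [hp, hq]
  | monomial u a =>
    have : MvPolynomial.aeval (fun i => C (y i) * (X : K[X])) (MvPolynomial.monomial u a) =
        C (MvPolynomial.eval y (MvPolynomial.monomial u a)) * X ^ u.degree := by
      rw [MvPolynomial.aeval_monomial, MvPolynomial.eval_monomial]
      simp only [mul_pow, Finsupp.prod_mul, algebraMap_eq, map_mul]
      rw [mul_assoc]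
      congr 2
      · simp [Finsupp.prod]
      · simp [Finsupp.prod, Finset.prod_pow_eq_pow_sum, Finsupp.degree_apply]
    rw [this, coeff_C_mul, coeff_X_pow]
    split_ifs with h
    · rw [MvPolynomial.homogeneousComponent_of_mem
        (MvPolynomial.isHomogeneous_monomial a h.symm)]
      simp
    · rw [MvPolynomial.homogeneousComponent_of_mem
        (MvPolynomial.isHomogeneous_monomial a rfl), if_neg h]
      simp

/-- A polynomial in several variables whose values grow at most like the `M`-th power of the
size of the argument has total degree at most `M`. -/
theorem totalDegree_le_of_valuation_eval_le [Infinite K] {σ : Type*} [Finite σ]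
    (hv : Function.Surjective v) (h1 : ∃ x, 1 < v x) (g : MvPolynomial σ K) {C : Γ₀} {M : ℕ}
    (h : ∀ (t : σ → K) (ρ : Γ₀), 1 ≤ ρ → (∀ i, v (t i) ≤ ρ) →
      v (MvPolynomial.eval t g) ≤ C * ρ ^ M) :
    g.totalDegree ≤ M := by
  classical
  rcases eq_or_ne g 0 with rfl | hg
  · simp
  have hne : MvPolynomial.homogeneousComponent g.totalDegree g ≠ 0 := by
    obtain ⟨u, hu, hdeg⟩ := Finset.exists_mem_eq_sup g.support
      (MvPolynomial.support_nonempty.mpr hg) fun s => s.sum fun _ e => e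
    intro h0
    have := congrArg (MvPolynomial.coeff u) h0
    rw [MvPolynomial.coeff_homogeneousComponent, if_pos (show u.degree = g.totalDegree from hdeg.symm)] at this
    exact MvPolynomial.mem_support_iff.mp hu (by simpa using this)
  obtain ⟨y, hy⟩ : ∃ y, MvPolynomial.eval y
      (MvPolynomial.homogeneousComponent g.totalDegree g) ≠ 0 := by
    by_contra! h0
    exact hne (MvPolynomial.funext fun y => by simpa using h0 y)
  set p : K[X] := MvPolynomial.aeval (fun i => Polynomial.C (y i) * (X : K[X])) g with hp
  have hpc : p.coeff g.totalDegree ≠ 0 := by rwa [hp, coeff_aeval_C_mul_X]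
  refine (le_natDegree_of_ne_zero hpc).trans ?_
  have := Fintype.ofFinite σ
  obtain ⟨S, hS⟩ := Finset.exists_le (insert 1 (Finset.univ.image fun i => v (y i)))
  have hS1 : 1 ≤ S := hS _ (Finset.mem_insert_self _ _)
  refine natDegree_le_of_valuation_eval_le v hv h1 p (C := C * S ^ M) fun x hx => ?_
  have he : p.eval x = MvPolynomial.eval (fun i => y i * x) g := by
    rw [hp, ← coe_evalRingHom, ← MvPolynomial.coe_aeval_eq_eval]
    change ((evalRingHom x).comp (MvPolynomial.aeval _).toRingHom) g = (MvPolynomial.aeval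
      (fun i => y i * x)).toRingHom g
    congr 1
    ext <;> simp
  rw [he, mul_assoc, ← mul_pow]
  refine h _ _ (one_le_mul hS1 hx) fun i => ?_
  rw [map_mul]
  gcongr
  exact hS _ (Finset.mem_insert_of_mem (Finset.mem_image_of_mem _ (Finset.mem_univ i)))

end Valuation

/-! ### Preperiodicity from preperiodicity at all points -/

/-- A `K`-point of `R` extends along an integral `K`-algebra morphism `φ : R → B` as soon as it
kills the kernel of `φ`. -/
theorem exists_algHom_comp_eq {K R B : Type*} [Field K] [IsAlgClosed K] [CommRing R] [CommRing B]
    [Algebra K R] [Algebra K B] (φ : R →ₐ[K] B) (hφ : φ.toRingHom.IsIntegral) (χ : R →ₐ[K] K)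
    (hker : ∀ r, φ r = 0 → χ r = 0) : ∃ ψ : B →ₐ[K] K, ∀ r, ψ (φ r) = χ r := by
  algebraize [φ.toRingHom]
  have hP : (RingHom.ker χ.toRingHom).IsPrime := RingHom.ker_isPrime _
  obtain ⟨Q, -, hQ, hQP⟩ := Ideal.exists_ideal_over_prime_of_isIntegral
    (RingHom.ker χ.toRingHom) (⊥ : Ideal B) (fun r hr => hker r hr)
  have hmem : ∀ r, φ r ∈ Q ↔ χ r = 0 := fun r => by
    rw [show χ r = 0 ↔ r ∈ RingHom.ker χ.toRingHom from Iff.rfl, ← hQP]; rfl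
  have hred : ∀ r, Ideal.Quotient.mk Q (φ r) = algebraMap K (B ⧸ Q) (χ r) := fun r => by
    rw [← Ideal.Quotient.mk_algebraMap, ← φ.commutes, Ideal.Quotient.eq, ← map_sub, hmem]
    simp
  have hint : (algebraMap K (B ⧸ Q)).IsIntegral := by
    intro y
    obtain ⟨b, rfl⟩ := Ideal.Quotient.mk_surjective y
    obtain ⟨p, hp, hpb⟩ := hφ b
    refine ⟨p.map χ.toRingHom, hp.map _, ?_⟩
    have := congrArg (Ideal.Quotient.mk Q) hpb
    rw [map_zero, hom_eval₂] at this
    rw [eval₂_map, ← this]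
    congr 1
    ext r
    exact (hred r).symm
  have hbij := IsAlgClosed.ringHom_bijective_of_isIntegral (algebraMap K (B ⧸ Q)) hint
  let e : K ≃ₐ[K] (B ⧸ Q) := AlgEquiv.ofBijective (Algebra.ofId K (B ⧸ Q)) hbij
  refine ⟨e.symm.toAlgHom.comp (Ideal.Quotient.mkₐ K Q), fun r => ?_⟩
  change e.symm (Ideal.Quotient.mk Q (φ r)) = _
  rw [hred]
  exact e.symm_apply_apply (χ r)

section Growth

variable {K Γ₀ B σ : Type*} [Field K] [LinearOrderedCommGroupWithZero Γ₀] (v : Valuation K Γ₀)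
  [CommRing B] [Algebra K B] (g : MvPolynomial σ K →ₐ[K] B)

/-- The values of `b` at the `K`-points of `B` grow at most like the `M`-th power of the size of
the coordinate functions `g (X i)`. -/
def HasGrowth (C : Γ₀) (M : ℕ) (b : B) : Prop :=
  ∀ (χ : B →ₐ[K] K) (ρ : Γ₀), 1 ≤ ρ → (∀ i, v (χ (g (.X i))) ≤ ρ) → v (χ b) ≤ C * ρ ^ M

variable {v g}

theorem HasGrowth.mono {C C' : Γ₀} {M M' : ℕ} {b : B} (h : HasGrowth v g C M b) (hC : C ≤ C')
    (hM : M ≤ M') : HasGrowth v g C' M' b := fun χ ρ h1 hρ =>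
  (h χ ρ h1 hρ).trans (by gcongr)

theorem HasGrowth.sub {C : Γ₀} {M : ℕ} {b b' : B} (h : HasGrowth v g C M b)
    (h' : HasGrowth v g C M b') : HasGrowth v g C M (b - b') := fun χ ρ h1 hρ => by
  rw [map_sub]
  exact v.map_sub_le (h χ ρ h1 hρ) (h' χ ρ h1 hρ)

variable (v g)

theorem exists_hasGrowth_finset (s : Finset B) (hs : ∀ b ∈ s, ∃ C M, HasGrowth v g C M b) :
    ∃ C M, 1 ≤ C ∧ ∀ b ∈ s, HasGrowth v g C M b := by
  classical
  induction s using Finset.induction_on with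
  | empty => exact ⟨1, 0, le_rfl, by simp⟩
  | insert a s _ ih =>
    obtain ⟨C, M, h1, h⟩ := ih fun b hb => hs b (Finset.mem_insert_of_mem hb)
    obtain ⟨C', M', h'⟩ := hs a (Finset.mem_insert_self _ _)
    refine ⟨max C C', max M M', h1.trans (le_max_left _ _), fun b hb => ?_⟩
    rcases Finset.mem_insert.mp hb with rfl | hb
    · exact h'.mono (le_max_right _ _) (le_max_right _ _)
    · exact (h b hb).mono (le_max_left _ _) (le_max_left _ _)

theorem exists_hasGrowth_apply (p : MvPolynomial σ K) : ∃ C M, HasGrowth v g C M (g p) := by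
  induction p using MvPolynomial.induction_on with
  | C a =>
    refine ⟨v a, 0, fun χ ρ _ _ => ?_⟩
    rw [← MvPolynomial.algebraMap_eq, g.commutes, χ.commutes]
    simp
  | add p q hp hq =>
    obtain ⟨C, M, h⟩ := hp
    obtain ⟨C', M', h'⟩ := hq
    refine ⟨max C C', max M M', fun χ ρ h1 hρ => ?_⟩
    rw [map_add, map_add]
    exact v.map_add_le (h.mono (le_max_left _ _) (le_max_left _ _) χ ρ h1 hρ)
      (h'.mono (le_max_right _ _) (le_max_right _ _) χ ρ h1 hρ)
  | mul_X p i hp =>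
    obtain ⟨C, M, h⟩ := hp
    refine ⟨C, M + 1, fun χ ρ h1 hρ => ?_⟩
    rw [map_mul, map_mul, map_mul, pow_succ, ← mul_assoc]
    exact mul_le_mul' (h χ ρ h1 hρ) (hρ i)

theorem exists_hasGrowth_of_isIntegral {b : B} (hb : g.toRingHom.IsIntegralElem b) :
    ∃ C M, HasGrowth v g C M b := by
  classical
  obtain ⟨q, hq, hqb⟩ := hb
  obtain ⟨C, M, h1, h⟩ := exists_hasGrowth_finset v g
    ((Finset.range (q.natDegree + 1)).image fun j => g (q.coeff j))
    fun b hb => by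
      obtain ⟨j, -, rfl⟩ := Finset.mem_image.mp hb
      exact exists_hasGrowth_apply v g _
  refine ⟨C, M, fun χ ρ hρ1 hρ => ?_⟩
  have hY : 1 ≤ C * ρ ^ M := one_le_mul h1 (one_le_pow_of_one_le' hρ1 M)
  refine valuation_root_le v (q.map (χ.comp g).toRingHom) (hq.map _) hY (fun j => ?_) ?_
  · rw [coeff_map]
    by_cases hj : j < q.natDegree + 1
    · exact h _ (Finset.mem_image_of_mem _ (Finset.mem_range.mpr hj)) χ ρ hρ1 hρ
    · rw [coeff_eq_zero_of_natDegree_lt (by omega), map_zero, map_zero]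
      exact zero_le
  · rw [Polynomial.eval_map]
    have := congrArg χ.toRingHom hqb
    rw [hom_eval₂, map_zero] at this
    exact this

end Growth

/-- Over a Noether normalization `g`, the elements of a given growth are determined by
their values at finitely many `K`-points: the constant coefficient of the minimal polynomial of
such an element is a polynomial of bounded degree. -/
theorem exists_finite_separating {K Γ₀ B : Type*} [Field K] [IsAlgClosed K]
    [LinearOrderedCommGroupWithZero Γ₀] (v : Valuation K Γ₀) (hv : Function.Surjective v)
    (hv1 : ∃ x, 1 < v x) [CommRing B] [IsDomain B] [Algebra K B] {m : ℕ}
    (g : MvPolynomial (Fin m) K →ₐ[K] B) (hg : Function.Injective g) (hfin : g.Finite)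
    {C : Γ₀} (hC : 1 ≤ C) (M : ℕ) :
    ∃ S : Set (B →ₐ[K] K), S.Finite ∧
      ∀ b, HasGrowth v g C M b → (∀ χ ∈ S, χ b = 0) → b = 0 := by
  classical
  have : Infinite K := IsAlgClosed.instInfinite
  have hint : g.toRingHom.IsIntegral := RingHom.Finite.to_isIntegral hfin
  let := g.toRingHom.toAlgebra
  have halg : ∀ p, algebraMap (MvPolynomial (Fin m) K) B p = g p := fun p => rfl
  have : Module.Finite (MvPolynomial (Fin m) K) B := hfin
  have : FaithfulSMul (MvPolynomial (Fin m) K) B := (faithfulSMul_iff_algebraMap_injective _ _).mpr hg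
  -- one `K`-point over every point of the base
  have hex : ∀ t : Fin m → K, ∃ χ : B →ₐ[K] K, ∀ p, χ (g p) = MvPolynomial.eval t p := by
    intro t
    obtain ⟨χ, hχ⟩ := exists_algHom_comp_eq g hint (MvPolynomial.aeval t)
      (fun r hr => by rw [(map_eq_zero_iff g hg).mp hr, map_zero])
    exact ⟨χ, fun p => by rw [hχ, MvPolynomial.aeval_eq_eval]⟩
  choose χ hχ using hex
  set D := (⊤ : Submodule (MvPolynomial (Fin m) K) B).spanFinrank
  have hD : ∀ b : B, (minpoly (MvPolynomial (Fin m) K) b).natDegree ≤ D := fun b =>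
    minpoly.natDegree_le_spanFinrank _ b
  obtain ⟨T, hT⟩ := Infinite.exists_subset_card_eq K (M * D + 1)
  refine ⟨χ '' (Set.univ.pi fun _ => (T : Set K)),
    (Set.Finite.pi fun _ => T.finite_toSet).image _, fun b hb hb0 => ?_⟩
  have hbi : IsIntegral (MvPolynomial (Fin m) K) b := hint b
  set q := minpoly (MvPolynomial (Fin m) K) b with hq
  have hqm : q.Monic := minpoly.monic hbi
  have hdeg : (q.coeff 0).totalDegree ≤ M * D := by
    refine totalDegree_le_of_valuation_eval_le v hv hv1 _ (C := C ^ D) fun t ρ hρ1 hρ => ?_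
    have hY : 1 ≤ C * ρ ^ M := one_le_mul hC (one_le_pow_of_one_le' hρ1 M)
    set qt := q.map (MvPolynomial.eval t) with hqt
    have hqtm : qt.Monic := hqm.map _
    -- the roots of the specialized minimal polynomial are values of `b` at `K`-points
    have hroot : ∀ r ∈ qt.roots, v r ≤ C * ρ ^ M := by
      intro r hr
      let χr : (MvPolynomial (Fin m) K)[X] →ₐ[K] K :=
        { (eval₂RingHom (MvPolynomial.eval t) r) with
          commutes' := fun a => by
            rw [IsScalarTower.algebraMap_apply K (MvPolynomial (Fin m) K)]
            simp [MvPolynomial.algebraMap_eq] }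
      let φb : (MvPolynomial (Fin m) K)[X] →ₐ[K] B :=
        { (eval₂RingHom g.toRingHom b) with
          commutes' := fun a => by
            rw [IsScalarTower.algebraMap_apply K (MvPolynomial (Fin m) K)]
            simp [MvPolynomial.algebraMap_eq] }
      have hφb : φb.toRingHom.IsIntegral := fun y =>
        RingHom.isIntegralElem.of_comp Polynomial.C φb.toRingHom (x := y) (by
          have : φb.toRingHom.comp Polynomial.C = g.toRingHom := by ext <;> simp [φb]
          rw [this]
          exact hint y)
      obtain ⟨ψ, hψ⟩ := exists_algHom_comp_eq φb hφb χr (fun p hp => by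
        obtain ⟨p', rfl⟩ := minpoly.isIntegrallyClosed_dvd hbi (p := p) hp
        rw [map_mul]
        have : χr q = qt.eval r := (Polynomial.eval_map _ _).symm
        rw [← hq, this, (mem_roots'.mp hr).2, zero_mul])
      have h1 : ψ b = r := by simpa [φb, χr] using hψ X
      have h2 : ∀ i, ψ (g (.X i)) = t i := fun i => by
        simpa [φb, χr] using hψ (Polynomial.C (.X i))
      rw [← h1]
      exact hb ψ ρ hρ1 fun i => by rw [h2]; exact hρ i
    have hc : MvPolynomial.eval t (q.coeff 0) = (-1) ^ qt.natDegree * qt.roots.prod := by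
      rw [← (IsAlgClosed.splits qt).coeff_zero_eq_prod_roots_of_monic hqtm, hqt, coeff_map]
    have hprod : ∀ s : Multiset K, (∀ r ∈ s, v r ≤ C * ρ ^ M) →
        v s.prod ≤ (C * ρ ^ M) ^ s.card := by
      intro s
      induction s using Multiset.induction_on with
      | empty => simp
      | cons a s ih =>
        intro h
        rw [Multiset.prod_cons, map_mul, Multiset.card_cons, pow_succ']
        exact mul_le_mul' (h a (Multiset.mem_cons_self _ _))
          (ih fun r hr => h r (Multiset.mem_cons_of_mem hr))
    rw [hc, map_mul, map_pow, Valuation.map_neg, map_one, one_pow, one_mul]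
    calc v qt.roots.prod ≤ (C * ρ ^ M) ^ qt.roots.card := hprod _ hroot
      _ ≤ (C * ρ ^ M) ^ D := pow_le_pow_right₀ hY
        ((card_roots' qt).trans (natDegree_map_le.trans (hD b)))
      _ = C ^ D * ρ ^ (M * D) := by rw [mul_pow, pow_mul]
  have hzero : q.coeff 0 = 0 := by
    refine MvPolynomial.eq_zero_of_eval_zero_at_prod_finset _ (fun _ => T) (fun i => ?_)
      fun t ht => ?_
    · rw [hT]
      exact Nat.lt_succ_of_le ((MvPolynomial.degreeOf_le_totalDegree _ _).trans hdeg)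
    · have h0 : χ t b = 0 := hb0 _ ⟨t, fun i _ => ht i, rfl⟩
      have h1 := congrArg (χ t).toRingHom (minpoly.aeval (MvPolynomial (Fin m) K) b)
      rw [← hq, map_zero, aeval_def, hom_eval₂] at h1
      change eval₂ _ (χ t b) q = 0 at h1
      rw [h0, eval₂_at_zero] at h1
      rw [← hχ]
      exact h1
  by_contra hb'
  obtain ⟨q', hq'⟩ := X_dvd_iff.mpr hzero
  have h1 : q' ≠ 0 := by
    rintro rfl
    exact hqm.ne_zero (by rw [hq', mul_zero])
  have h2 : aeval b q' = 0 := by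
    have := minpoly.aeval (MvPolynomial (Fin m) K) b
    rw [← hq, hq', map_mul, aeval_X] at this
    exact (mul_eq_zero.mp this).resolve_left hb'
  have h3 := natDegree_le_of_dvd (minpoly.isIntegrallyClosed_dvd hbi h2) h1
  rw [← hq, hq', natDegree_X_mul h1] at h3
  omega

/-- If the specialization of `z` at every `K`-point of the domain `B` is preperiodic for the
specialization of the polynomial `f`, then `z` is preperiodic for `f`. The values of the iterates
of `z` at the `K`-points have uniformly bounded growth, because points of large absolute value
escape, so the iterates are determined by their values at finitely many `K`-points; these values
range over a finite set. -/
theorem exists_iterate_eq_of_forall_algHom {K B : Type*} [Field K] [IsAlgClosed K] [CharZero K]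
    [CommRing B] [IsDomain B] [Algebra K B] [Algebra.FiniteType K B] (f : B[X])
    (hd : 2 ≤ f.natDegree) (hf : IsUnit f.leadingCoeff) (z : B)
    (hz : ∀ χ : B →ₐ[K] K, {w : K | ∃ n : ℕ, 1 ≤ n ∧
      w = (fun t => (f.map χ.toRingHom).eval t)^[n] (χ z)}.Finite) :
    ∃ a b : ℕ, a < b ∧ (fun t => f.eval t)^[a] z = (fun t => f.eval t)^[b] z := by
  classical
  obtain ⟨V, hV⟩ := exists_valuationSubring_one_lt K
  set v := V.valuation
  have hv : Function.Surjective v := V.valuation_surjective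
  obtain ⟨m, g, hg, hfin⟩ := exists_finite_inj_algHom_of_fg K B
  obtain ⟨u, hu⟩ := hf
  obtain ⟨C, M, hC, hgrow⟩ := exists_hasGrowth_finset v g
    (insert (↑u⁻¹ : B) ((Finset.range (f.natDegree + 1)).image fun j => f.coeff j * ↑u⁻¹))
    fun b _ => exists_hasGrowth_of_isIntegral v g (RingHom.Finite.to_isIntegral hfin b)
  have hiter : ∀ (χ : B →ₐ[K] K) (n : ℕ), χ ((fun t => f.eval t)^[n] z) =
      (fun t => (f.map χ.toRingHom).eval t)^[n] (χ z) := by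
    intro χ n
    refine (Function.Semiconj.iterate_right (f := χ) (fun t => ?_) n) z
    change χ.toRingHom (f.eval t) = _
    rw [← eval_map_apply]
    rfl
  have horb : ∀ n, 1 ≤ n → HasGrowth v g C M ((fun t => f.eval t)^[n] z) := by
    intro n hn χ ρ hρ1 hρ
    have hY : 1 ≤ C * ρ ^ M := one_le_mul hC (one_le_pow_of_one_le' hρ1 M)
    have hχu : χ ↑u⁻¹ = (χ ↑u)⁻¹ := by
      rw [← mul_eq_one_iff_eq_inv₀ (u.isUnit.map χ).ne_zero, ← map_mul, Units.inv_mul, map_one]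
    have hlc : χ.toRingHom f.leadingCoeff ≠ 0 := by
      rw [← hu]; exact (u.isUnit.map χ).ne_zero
    have hlc' : (f.map χ.toRingHom).leadingCoeff = χ u := by
      rw [leadingCoeff_map_of_leadingCoeff_ne_zero _ hlc, ← hu]; rfl
    rw [hiter]
    refine valuation_iterate_le_of_finite v (f.map χ.toRingHom) ?_ hY ?_ (fun j => ?_) (hz χ) hn
    · rwa [natDegree_map_of_leadingCoeff_ne_zero _ hlc]
    · rw [hlc', ← hχu]
      exact hgrow _ (Finset.mem_insert_self _ _) χ ρ hρ1 hρ
    · rw [hlc', ← hχu, coeff_map]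
      change v (χ _ * χ _) ≤ _
      rw [← map_mul]
      by_cases hj : j < f.natDegree + 1
      · exact hgrow _ (Finset.mem_insert_of_mem
          (Finset.mem_image_of_mem _ (Finset.mem_range.mpr hj))) χ ρ hρ1 hρ
      · rw [coeff_eq_zero_of_natDegree_lt (by omega), zero_mul, map_zero, map_zero]
        exact zero_le
  obtain ⟨S, hS, hsep⟩ := exists_finite_separating v hv hV g hg hfin hC M
  have := hS.to_subtype
  -- two iterates take the same values at the points of `S`
  obtain ⟨a, b, hab, heq⟩ := Set.Finite.exists_lt_map_eq_of_forall_mem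
    (t := Set.univ.pi fun χ : S => {w : K | ∃ n : ℕ, 1 ≤ n ∧
      w = (fun t => (f.map χ.1.toRingHom).eval t)^[n] (χ.1 z)})
    (f := fun (n : ℕ) (χ : S) => χ.1 ((fun t => f.eval t)^[n + 1] z))
    (fun n χ _ => ⟨n + 1, by omega, hiter _ _⟩) (Set.Finite.pi fun χ => hz χ.1)
  refine ⟨a + 1, b + 1, by omega, sub_eq_zero.mp (hsep _
    ((horb _ (by omega)).sub (horb _ (by omega))) fun χ hχ => ?_)⟩
  rw [map_sub, sub_eq_zero]
  exact congrFun heq ⟨χ, hχ⟩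

/-! ### Irreducible components in Noetherian spaces -/

section Topology

open TopologicalSpace

variable {T T' : Type*} [TopologicalSpace T] [TopologicalSpace T']

theorem IsComponentOf.eq_of_subset {S Z Y : Set T} (hZ : IsComponentOf S Z)
    (hY : IsIrreducible Y) (hYS : Y ⊆ S) (h : Z ⊆ Y) : Z = Y :=
  Maximal.eq_of_subset hZ ⟨hY, hYS⟩ h

theorem IsComponentOf.isClosed {S Z : Set T} (hS : IsClosed S) (hZ : IsComponentOf S Z) :
    IsClosed Z := by
  have := IsComponentOf.eq_of_subset hZ hZ.prop.1.closure
    (hS.closure_subset_iff.mpr hZ.prop.2) subset_closure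
  rw [this]
  exact isClosed_closure

/-- By Zorn's lemma, every point of a set lies on a component of it. -/
theorem exists_isComponentOf_mem {S : Set T} {x : T} (hx : x ∈ S) :
    ∃ Z, IsComponentOf S Z ∧ x ∈ Z := by
  have hchain : ∀ c ⊆ {Y : Set T | IsIrreducible Y ∧ Y ⊆ S}, IsChain (· ⊆ ·) c → c.Nonempty →
      ∃ ub ∈ {Y : Set T | IsIrreducible Y ∧ Y ⊆ S}, ∀ s ∈ c, s ⊆ ub := by
    refine fun c hc hchain ⟨s, hs⟩ => ⟨⋃₀ c, ⟨⟨?_, ?_⟩, ?_⟩, fun s => Set.subset_sUnion_of_mem⟩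
    · exact (hc hs).1.1.mono (Set.subset_sUnion_of_mem hs)
    · rintro U V hU hV ⟨y, ⟨s, hs, hys⟩, hyU⟩ ⟨y', ⟨s', hs', hys'⟩, hyV⟩
      rcases hchain.total hs hs' with h | h
      · obtain ⟨w, hw, hwU⟩ := (hc hs').1.2 U V hU hV ⟨y, h hys, hyU⟩ ⟨y', hys', hyV⟩
        exact ⟨w, ⟨s', hs', hw⟩, hwU⟩
      · obtain ⟨w, hw, hwU⟩ := (hc hs).1.2 U V hU hV ⟨y, hys, hyU⟩ ⟨y', h hys', hyV⟩
        exact ⟨w, ⟨s, hs, hw⟩, hwU⟩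
    · exact Set.sUnion_subset fun s hs => (hc hs).2
  obtain ⟨Z, hxZ, hZ⟩ := zorn_subset_nonempty _ hchain {x} ⟨isIrreducible_singleton, by simpa⟩
  exact ⟨Z, hZ, hxZ rfl⟩

/-- A hypersurface contained in a closed set with empty interior is one of its components. -/
theorem isComponentOf_of_coheight_eq_one [NoetherianSpace T] (Z : IrreducibleCloseds T)
    (hZ : Order.coheight Z = 1) {S : Set T} (hS : IsClosed S) (hint : interior S = ∅)
    (hZS : (Z : Set T) ⊆ S) : IsComponentOf S (Z : Set T) := by
  refine ⟨⟨Z.isIrreducible, hZS⟩, fun Y hY hZY => ?_⟩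
  let Y' : IrreducibleCloseds T := ⟨closure Y, hY.1.closure, isClosed_closure⟩
  have hY'S : closure Y ⊆ S := hS.closure_subset_iff.mpr hY.2
  have hle : Z ≤ Y' := fun x hx => subset_closure (hZY hx)
  rcases hle.eq_or_lt with h | h
  · rw [h]; exact subset_closure
  exfalso
  -- an irreducible closed set strictly larger than `Z` is a component of the space, so it has
  -- nonempty interior
  obtain ⟨W, hW, hYW, hWmax⟩ := exists_preirreducible (closure Y) hY.1.closure.isPreirreducible
  have hWirr : IsIrreducible W := ⟨hY.1.closure.nonempty.mono hYW, hW⟩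
  have hWcl : closure W = W := hWmax _ hWirr.closure.isPreirreducible subset_closure
  let W' : IrreducibleCloseds T := ⟨W, hWirr, closure_eq_iff_isClosed.mp hWcl⟩
  have hYW' : Y' ≤ W' := hYW
  rcases hYW'.eq_or_lt with h' | h'
  · have hcomp : W ∈ irreducibleComponents T :=
      ⟨hWirr, fun V hV hWV => (hWmax V hV.isPreirreducible hWV).le⟩
    obtain ⟨o, ho, hne, hoW⟩ := NoetherianSpace.exists_isOpen_nonempty_subset_irreducibleComponent W hcomp
    have h1 : closure Y = W := congrArg (fun V : IrreducibleCloseds T => (V : Set T)) h'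
    have : o ⊆ interior S := interior_maximal (hoW.trans (h1 ▸ hY'S)) ho
    rw [hint] at this
    exact hne.ne_empty (Set.subset_empty_iff.mp this)
  · have h1 : Order.coheight W' + 1 ≤ Order.coheight Y' := Order.coheight_add_one_le h'
    have h2 : Order.coheight Y' + 1 ≤ Order.coheight Z := Order.coheight_add_one_le h
    rw [hZ] at h2
    have h3 : (0 + 1 + 1 : ℕ∞) ≤ 1 := le_trans (by gcongr; exact le_trans (by gcongr; simp) h1) h2
    revert h3
    decide

/-- A closed subset of a Noetherian space has finitely many components. -/
theorem finite_isComponentOf [NoetherianSpace T] {S : Set T} (hS : IsClosed S) :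
    {Z | IsComponentOf S Z}.Finite := by
  obtain ⟨F, hF, hFc, hFi, hSF⟩ := NoetherianSpace.exists_finite_set_isClosed_irreducible hS
  refine hF.subset fun Z (hZ : IsComponentOf S Z) => ?_
  obtain ⟨Y, hY, hZY⟩ := isIrreducible_iff_sUnion_isClosed.mp hZ.prop.1 hF.toFinset
    (fun z hz => hFc z (hF.mem_toFinset.mp hz)) (by simpa [← hSF] using hZ.prop.2)
  have hY := hF.mem_toFinset.mp hY
  rwa [hZ.eq_of_subset (hFi Y hY) (hSF ▸ Set.subset_sUnion_of_mem hY) hZY]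

/-- The components of the preimage of an irreducible closed set under an open continuous map
dominate that set. -/
theorem subset_closure_image_of_isComponentOf [NoetherianSpace T'] {q : T' → T}
    (hq : Continuous q) (hqo : IsOpenMap q) {Z : Set T} (hZ : IsIrreducible Z) (hZc : IsClosed Z)
    {Z' : Set T'} (hZ' : IsComponentOf (q ⁻¹' Z) Z') : Z ⊆ closure (q '' Z') := by
  have hfin := (finite_isComponentOf (hZc.preimage hq)).subset
    (Set.sdiff_subset (t := {Z'}))
  -- the open complement of the other components
  set U : Set T' := (⋃₀ ({Y | IsComponentOf (q ⁻¹' Z) Y} \ {Z'}))ᶜ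
  have hU : IsOpen U := by
    rw [isOpen_compl_iff]
    rw [Set.sUnion_eq_biUnion]
    exact hfin.isClosed_biUnion fun Y hY => IsComponentOf.isClosed (hZc.preimage hq) hY.1
  have hUZ : q ⁻¹' Z ∩ U ⊆ Z' := by
    rintro x ⟨hx, hxU⟩
    obtain ⟨Y, hY, hxY⟩ := exists_isComponentOf_mem hx
    by_cases h : Y = Z'
    · rwa [← h]
    · exact absurd ⟨Y, ⟨hY, h⟩, hxY⟩ hxU
  have hne : (Z' ∩ U).Nonempty := by
    by_contra! h
    have hsub : Z' ⊆ ⋃₀ (hfin.toFinset : Set (Set T')) := fun x hx => by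
      by_contra hx'
      rw [hfin.coe_toFinset] at hx'
      exact Set.notMem_empty x (h ▸ ⟨hx, hx'⟩)
    obtain ⟨Y, hY, hZY⟩ := isIrreducible_iff_sUnion_isClosed.mp hZ'.prop.1 hfin.toFinset
      (fun z hz => IsComponentOf.isClosed (hZc.preimage hq) (hfin.mem_toFinset.mp hz).1) hsub
    obtain ⟨hY, hne⟩ : IsComponentOf (q ⁻¹' Z) Y ∧ Y ≠ Z' := hfin.mem_toFinset.mp hY
    exact hne (hZ'.eq_of_subset hY.prop.1 hY.prop.2 hZY).symm
  obtain ⟨x, hxZ, hxU⟩ := hne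
  refine (subset_closure_inter_of_isPreirreducible_of_isOpen hZ.isPreirreducible
    (hqo U hU) ⟨q x, hZ'.prop.2 hxZ, x, hxU, rfl⟩).trans (closure_mono ?_)
  rintro _ ⟨hy, y, hyU, rfl⟩
  exact ⟨y, hUZ ⟨hy, hyU⟩, rfl⟩

end Topology

/-! ### Points and regular functions -/

section Points

variable {K : Type u} [Field K]

/-- The value of a global function at a point with values in `K`. -/
noncomputable def valueAt {X : Scheme.{u}} (x : Spec (.of K) ⟶ X) : Γ(X, ⊤) →+* K :=
  (Scheme.ΓSpecIso (.of K)).hom.hom.comp x.appTop.hom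

theorem valueAt_comp {X Y : Scheme.{u}} (x : Spec (.of K) ⟶ X) (f : X ⟶ Y) (g : Γ(Y, ⊤)) :
    valueAt (x ≫ f) g = valueAt x (f.appTop g) := by
  simp only [valueAt, Scheme.Hom.comp_appTop, CommRingCat.hom_comp, RingHom.comp_apply]

theorem valueAt_SpecMap {R : CommRingCat.{u}} (φ : R ⟶ .of K) (r : R) :
    valueAt (Spec.map φ) ((Scheme.ΓSpecIso R).inv r) = φ r := by
  have := congrArg (fun f => f.hom ((Scheme.ΓSpecIso R).inv r)) (Scheme.ΓSpecIso_naturality φ)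
  simp only [CommRingCat.hom_comp, RingHom.comp_apply] at this
  refine Eq.trans this ?_
  simp

theorem valueAt_SpecMap' {R : CommRingCat.{u}} (φ : R ⟶ .of K) (g : Γ(Spec R, ⊤)) :
    valueAt (Spec.map φ) g = φ ((Scheme.ΓSpecIso R).hom g) := by
  rw [← valueAt_SpecMap, ← CommRingCat.comp_apply, Iso.hom_inv_id, CommRingCat.id_apply]

theorem isUnit_iff_basicOpen_eq_top {X : Scheme.{u}} (g : Γ(X, ⊤)) :
    IsUnit g ↔ X.basicOpen g = ⊤ := by
  refine ⟨fun h => Scheme.basicOpen_of_isUnit _ h, fun h => ?_⟩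
  refine RingedSpace.isUnit_of_isUnit_germ X.toLocallyRingedSpace.toRingedSpace ⊤ g fun x hx => ?_
  exact (Scheme.mem_basicOpen_top X g x).mp (h.symm ▸ hx)

/-- A `K`-point, as a point of the underlying space, lies in the basic open set of `g` exactly if
the value of `g` there is nonzero. -/
theorem mem_basicOpen_iff {X : Scheme.{u}} (x : Spec (.of K) ⟶ X) (g : Γ(X, ⊤)) :
    x (IsLocalRing.closedPoint K) ∈ X.basicOpen g ↔ valueAt x g ≠ 0 := by
  have h1 : x (IsLocalRing.closedPoint K) ∈ X.basicOpen g ↔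
      (IsLocalRing.closedPoint K : Spec (.of K)) ∈ (Spec (.of K)).basicOpen (x.appTop g) := by
    rw [← Scheme.preimage_basicOpen_top]; rfl
  rw [h1]
  have h2 : valueAt x g ≠ 0 ↔ IsUnit (x.appTop g) := by
    rw [← isUnit_iff_ne_zero]
    exact isUnit_map_iff (Scheme.ΓSpecIso (.of K)).commRingCatIsoToRingEquiv (x.appTop g)
  rw [h2]
  constructor
  · intro h
    rw [isUnit_iff_basicOpen_eq_top]
    ext y
    exact ⟨fun _ => trivial, fun _ => Subsingleton.elim y (IsLocalRing.closedPoint K) ▸ h⟩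
  · intro h
    rw [Scheme.basicOpen_of_isUnit _ h]
    trivial

end Points

section LinePt

variable {K : Type u} [Field K] {Λ : Scheme.{u}} {s : Λ ⟶ Spec (.of K)}

theorem fiber_map {Λ' : Scheme.{u}} (π : Λ' ⟶ Λ) (x : Pt (π ≫ s)) (P : Γ(Λ, ⊤)[X]) :
    fiber (P.map π.appTop.hom) x = fiber P (x.map s π) := by
  rw [fiber, fiber, Polynomial.map_map]
  congr 1

/-- The morphism `Spec K ⟶ 𝔸¹_Λ` defined by a pair `(lam, z)`. -/
noncomputable def LinePt.hom (p : LinePt s) : Spec (.of K) ⟶ 𝔸(PUnit.{u + 1}; Λ) :=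
  AffineSpace.homOfVector p.lam.1
    (fun _ : PUnit.{u + 1} => (Scheme.ΓSpecIso (.of K)).inv.hom p.z)

theorem LinePt.hom_over (p : LinePt s) : p.hom ≫ 𝔸(PUnit.{u + 1}; Λ) ↘ Λ = p.lam.1 :=
  AffineSpace.homOfVector_over _ _

theorem LinePt.hom_comp (p : LinePt s) : p.hom ≫ 𝔸(PUnit.{u + 1}; Λ) ↘ Λ ≫ s = 𝟙 _ := by
  rw [← Category.assoc, p.hom_over, p.lam.2]

theorem LinePt.valueAt_coord (p : LinePt s) (i : PUnit) :
    valueAt p.hom (AffineSpace.coord Λ i) = p.z := by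
  simp [valueAt, LinePt.hom, AffineSpace.homOfVector_appTop_coord]

theorem hom_ext_of_valueAt {x y : Spec (.of K) ⟶ 𝔸(PUnit.{u + 1}; Λ)}
    (h : x ≫ 𝔸(PUnit.{u + 1}; Λ) ↘ Λ = y ≫ 𝔸(PUnit.{u + 1}; Λ) ↘ Λ)
    (h' : valueAt x (AffineSpace.coord Λ PUnit.unit) =
      valueAt y (AffineSpace.coord Λ PUnit.unit)) : x = y := by
  refine AffineSpace.hom_ext h fun i => ?_
  cases i
  exact (Scheme.ΓSpecIso (.of K)).commRingCatIsoToRingEquiv.injective h'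

/-- Every `K`-point of the scheme `𝔸¹_Λ` comes from a pair `(lam, z)`. -/
theorem LinePt.exists_hom_eq (x : Spec (.of K) ⟶ 𝔸(PUnit.{u + 1}; Λ))
    (hx : x ≫ 𝔸(PUnit.{u + 1}; Λ) ↘ Λ ≫ s = 𝟙 _) : ∃ p : LinePt s, p.hom = x :=
  ⟨⟨⟨x ≫ 𝔸(PUnit.{u + 1}; Λ) ↘ Λ, by rw [Category.assoc, hx]⟩,
    valueAt x (AffineSpace.coord Λ PUnit.unit)⟩,
    hom_ext_of_valueAt (LinePt.hom_over _) (LinePt.valueAt_coord _ _)⟩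

/-- The regular function on `𝔸¹_Λ` defined by a polynomial with coefficients in the ring of
regular functions on `Λ`. -/
noncomputable def lineFun (G : Γ(Λ, ⊤)[X]) : Γ(𝔸(PUnit.{u + 1}; Λ), ⊤) :=
  eval₂ (𝔸(PUnit.{u + 1}; Λ) ↘ Λ).appTop.hom (AffineSpace.coord Λ PUnit.unit) G

theorem LinePt.valueAt_lineFun (p : LinePt s) (G : Γ(Λ, ⊤)[X]) :
    valueAt p.hom (lineFun G) = (fiber G p.lam).eval p.z := by
  rw [lineFun, hom_eval₂, p.valueAt_coord, fiber, Polynomial.eval_map]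
  congr 1
  ext g
  change valueAt p.hom ((𝔸(PUnit.{u + 1}; Λ) ↘ Λ).appTop g) = _
  rw [← valueAt_comp, p.hom_over]
  rfl

theorem LinePt.continuous_toScheme : Continuous (LinePt.toScheme (s := s)) :=
  continuous_induced_dom

theorem LinePt.toScheme_eq (p : LinePt s) : p.toScheme = p.hom (IsLocalRing.closedPoint K) := rfl

/-- The zero locus of a polynomial is closed. -/
theorem isClosed_eval_eq_zero (G : Γ(Λ, ⊤)[X]) :
    IsClosed {p : LinePt s | (fiber G p.lam).eval p.z = 0} := by
  rw [← isOpen_compl_iff]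
  convert (𝔸(PUnit.{u + 1}; Λ).basicOpen (lineFun G)).2.preimage LinePt.continuous_toScheme using 1
  ext p
  change ¬ (fiber G p.lam).eval p.z = 0 ↔ p.toScheme ∈ 𝔸(PUnit.{u + 1}; Λ).basicOpen (lineFun G)
  rw [LinePt.toScheme_eq, mem_basicOpen_iff, LinePt.valueAt_lineFun]

theorem LinePt.continuous_lam : Continuous (LinePt.lam (s := s)) := by
  rw [continuous_induced_rng]
  have : (fun x : Pt s => x.1 (IsLocalRing.closedPoint K)) ∘ LinePt.lam =
      (𝔸(PUnit.{u + 1}; Λ) ↘ Λ) ∘ LinePt.toScheme := by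
    ext p
    change p.lam.1 _ = _
    rw [← p.hom_over]
    rfl
  rw [this]
  exact (𝔸(PUnit.{u + 1}; Λ) ↘ Λ).continuous.comp LinePt.continuous_toScheme

theorem isNoetherian_of_finiteType {X : Scheme.{u}} (f : X ⟶ Spec (.of K))
    [LocallyOfFiniteType f] [QuasiCompact f] : IsNoetherian X := by
  have := LocallyOfFiniteType.isLocallyNoetherian f
  have : CompactSpace X := QuasiCompact.compactSpace_of_compactSpace f
  exact {}

instance [LocallyOfFiniteType s] [QuasiCompact s] : TopologicalSpace.NoetherianSpace (LinePt s) := by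
  have := isNoetherian_of_finiteType (𝔸(PUnit.{u + 1}; Λ) ↘ Λ ≫ s)
  exact Topology.IsInducing.noetherianSpace (i := LinePt.toScheme) ⟨rfl⟩

/-- An open subset of `Λ × 𝔸¹` meets a vertical line in the complement of a finite set, or not
at all. -/
theorem finite_vertical_notMem {U : Set (LinePt s)} (hU : IsOpen U) {x : Pt s} {z₀ : K}
    (h : (⟨x, z₀⟩ : LinePt s) ∈ U) : {z | (⟨x, z⟩ : LinePt s) ∉ U}.Finite := by
  obtain ⟨V, hV, rfl⟩ := isOpen_induced_iff.mp hU
  let L : Spec (.of K[X]) ⟶ 𝔸(PUnit.{u + 1}; Λ) :=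
    AffineSpace.homOfVector (Spec.map (CommRingCat.ofHom Polynomial.C) ≫ x.1)
      (fun _ => (Scheme.ΓSpecIso (.of K[X])).inv.hom Polynomial.X)
  let e (z : K) : Spec (.of K) ⟶ Spec (.of K[X]) := Spec.map (CommRingCat.ofHom (evalRingHom z))
  have he : ∀ z, (⟨x, z⟩ : LinePt s).hom = e z ≫ L := by
    intro z
    apply hom_ext_of_valueAt
    · rw [LinePt.hom_over, Category.assoc, AffineSpace.homOfVector_over, ← Category.assoc,
        ← Spec.map_comp, ← CommRingCat.ofHom_comp]
      have : (evalRingHom z).comp Polynomial.C = RingHom.id K := by ext; simp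
      rw [this]
      simp
    · rw [LinePt.valueAt_coord, valueAt_comp, AffineSpace.homOfVector_appTop_coord]
      refine Eq.trans ?_ (valueAt_SpecMap _ _).symm
      simp
  have hmem : ∀ z, (⟨x, z⟩ : LinePt s) ∈ LinePt.toScheme ⁻¹' V ↔
      e z (IsLocalRing.closedPoint K) ∈ L ⁻¹' V := fun z => by
    change (⟨x, z⟩ : LinePt s).hom _ ∈ V ↔ _
    rw [he]
    rfl
  -- the trace of `V` on the line contains the set where some polynomial `r` does not vanish
  obtain ⟨_, ⟨r, rfl⟩, hr₀, hr⟩ := PrimeSpectrum.isTopologicalBasis_basic_opens.exists_subset_of_mem_open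
    ((hmem z₀).mp h) (hV.preimage L.continuous)
  have hval : ∀ z, e z (IsLocalRing.closedPoint K) ∈ (PrimeSpectrum.basicOpen r : Set (PrimeSpectrum K[X])) ↔
      r.eval z ≠ 0 := fun z => by
    have h1 := mem_basicOpen_iff (e z) ((Scheme.ΓSpecIso (.of K[X])).inv r)
    rw [valueAt_SpecMap, basicOpen_eq_of_affine] at h1
    exact h1
  have hr0 : r ≠ 0 := by
    rintro rfl
    exact (hval z₀).mp hr₀ (by simp)
  refine (r.rootSet_finite K).subset fun z hz => ?_
  rw [mem_rootSet]
  refine ⟨hr0, ?_⟩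
  by_contra hne
  exact hz ((hmem z).mpr (hr ((hval z).mpr (by simpa using hne))))

end LinePt

section Nullstellensatz

variable {K : Type u} [Field K] [IsAlgClosed K] {Λ : Scheme.{u}} (s : Λ ⟶ Spec (.of K))
  [LocallyOfFiniteType s]

theorem exists_pt_mem {U : Λ.Opens} (hU : (U : Set Λ).Nonempty) :
    ∃ x : Pt s, x.1 (IsLocalRing.closedPoint K) ∈ U := by
  have : JacobsonSpace Λ := LocallyOfFiniteType.jacobsonSpace s
  obtain ⟨y, hyU, hy⟩ := nonempty_inter_closedPoints
    hU U.2.isLocallyClosed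
  refine ⟨(pointEquivClosedPoint s).symm ⟨y, hy⟩, ?_⟩
  have hx : ((pointEquivClosedPoint s).symm ⟨y, hy⟩).1 (IsLocalRing.closedPoint K) = y :=
    congrArg Subtype.val ((pointEquivClosedPoint s).apply_symm_apply ⟨y, hy⟩)
  exact hx.symm ▸ hyU

/-- On a reduced scheme of finite type over an algebraically closed field, a regular function is
determined by its values at the `K`-points. -/
theorem eq_zero_of_forall_value_eq_zero [IsReduced Λ] (g : Γ(Λ, ⊤)) (h : ∀ x : Pt s, x.value g = 0) :
    g = 0 := by
  rw [← basicOpen_eq_bot_iff]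
  by_contra hne
  obtain ⟨x, hx⟩ := exists_pt_mem s (U := Λ.basicOpen g) (by
    rw [Set.nonempty_iff_ne_empty]
    exact fun h => hne (TopologicalSpace.Opens.ext h))
  exact (mem_basicOpen_iff x.1 g).mp hx (h x)

theorem isUnit_of_forall_value_ne_zero (g : Γ(Λ, ⊤)) (h : ∀ x : Pt s, x.value g ≠ 0) :
    IsUnit g := by
  rw [isUnit_iff_basicOpen_eq_top]
  by_contra hne
  have : JacobsonSpace Λ := LocallyOfFiniteType.jacobsonSpace s
  obtain ⟨y, hyU, hy⟩ := nonempty_inter_closedPoints (X := Λ) (Z := (Λ.basicOpen g : Set Λ)ᶜ)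
    (by
      rw [Set.nonempty_compl]
      exact fun h => hne (TopologicalSpace.Opens.ext h))
    (Λ.basicOpen g).2.isClosed_compl.isLocallyClosed
  let x : Pt s := (pointEquivClosedPoint s).symm ⟨y, hy⟩
  have hx : x.1 (IsLocalRing.closedPoint K) = y :=
    congrArg Subtype.val ((pointEquivClosedPoint s).apply_symm_apply ⟨y, hy⟩)
  exact hyU (hx ▸ (mem_basicOpen_iff x.1 g).mpr (h x))

end Nullstellensatz

/-! ### Base change by a monic equation -/

theorem isReduced_subscheme_nilradical (X : Scheme.{u}) :
    AlgebraicGeometry.IsReduced X.nilradical.subscheme := by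
  have h (U : X.affineOpens) : AlgebraicGeometry.IsReduced
      (X.nilradical.subschemeCover.openCover.X U) := by
    change AlgebraicGeometry.IsReduced (Spec (.of (Γ(X, U.1) ⧸ X.nilradical.ideal U)))
    have : _root_.IsReduced (Γ(X, U.1) ⧸ X.nilradical.ideal U) :=
      (Ideal.isRadical_iff_quotient_reduced _).mp (Ideal.radical_isRadical _)
    infer_instance
  have (i : X.nilradical.subschemeCover.openCover.I₀) : AlgebraicGeometry.IsReduced
      (X.nilradical.subschemeCover.openCover.X i) := h i
  exact IsReduced.of_openCover _ X.nilradical.subschemeCover.openCover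

theorem surjective_subschemeι_nilradical (X : Scheme.{u}) : Surjective X.nilradical.subschemeι := by
  refine ⟨Set.range_eq_univ.mp ?_⟩
  rw [Scheme.IdealSheafData.range_subschemeι, Scheme.support_nilradical]
  rfl

/-- A surjective closed immersion is a universal homeomorphism. -/
theorem universallyOpen_of_isClosedImmersion {X Y : Scheme.{u}} (f : X ⟶ Y) [IsClosedImmersion f]
    [Surjective f] : UniversallyOpen f := by
  refine ⟨fun X' Y' i₁ i₂ f' hf => ?_⟩
  have h1 : IsClosedImmersion f' := MorphismProperty.of_isPullback hf.flip inferInstance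
  have h2 : Surjective f' := MorphismProperty.of_isPullback hf.flip inferInstance
  exact (f'.isClosedEmbedding.toIsEmbedding.toHomeomorphOfSurjective h2.surj).isOpenMap

/-- A point with values in an algebraically closed field lifts along a surjective closed
immersion. -/
theorem exists_pt_comp_eq {K : Type u} [Field K] [IsAlgClosed K] {X Y : Scheme.{u}}
    (ι : X ⟶ Y) [IsClosedImmersion ι] [Surjective ι] (t : Y ⟶ Spec (.of K))
    [LocallyOfFiniteType t] (y : Spec (.of K) ⟶ Y) (hy : y ≫ t = 𝟙 _) :
    ∃ x : Spec (.of K) ⟶ X, x ≫ ι = y := by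
  obtain ⟨x, hx⟩ := ι.surjective (y (IsLocalRing.closedPoint K))
  have hyc : IsClosed {y (IsLocalRing.closedPoint K)} := (pointEquivClosedPoint t ⟨y, hy⟩).2
  have hxc : IsClosed {x} := by
    have : {x} = ι ⁻¹' {y (IsLocalRing.closedPoint K)} := by
      ext x'
      simp only [Set.mem_singleton_iff, Set.mem_preimage, ← hx]
      exact ι.isClosedEmbedding.injective.eq_iff.symm
    rw [this]
    exact hyc.preimage ι.continuous
  refine ⟨pointOfClosedPoint (ι ≫ t) x hxc, ext_of_apply_closedPoint_eq t ?_ hy ?_⟩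
  · rw [Category.assoc, pointOfClosedPoint_comp]
  · rw [← hx]
    exact congrArg ι (pointOfClosedPoint_apply (ι ≫ t) x hxc _)

/-- A finite, surjective, universally open base change over which a monic polynomial acquires a
root passing through a given root at a given point: the reduction of the zero locus of the
polynomial in `Λ × 𝔸¹`. -/
theorem exists_baseChange_of_monic {K : Type u} [Field K] [IsAlgClosed K] {Λ : Scheme.{u}}
    (s : Λ ⟶ Spec (.of K)) [LocallyOfFiniteType s] (F : Γ(Λ, ⊤)[X]) (hF : F.Monic)
    (lam₀ : Pt s) (c₀ : K) (hc₀ : (fiber F lam₀).eval c₀ = 0) :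
    ∃ (Λ' : Scheme.{u}) (π : Λ' ⟶ Λ) (lam₀' : Pt (π ≫ s)) (c : Γ(Λ', ⊤)),
      AlgebraicGeometry.IsReduced Λ' ∧ IsFinite π ∧ Surjective π ∧ UniversallyOpen π ∧
      lam₀'.map s π = lam₀ ∧ lam₀'.value c = c₀ ∧ eval₂ π.appTop.hom c F = 0 := by
  -- `AdjoinRoot F` is finite free, so its spectrum is finite, flat and of finite presentation over
  -- the base; this makes the projection universally open
  have hfree : Module.Free Γ(Λ, ⊤) (AdjoinRoot F) := hF.free_adjoinRoot
  have hfin : Module.Finite Γ(Λ, ⊤) (AdjoinRoot F) := hF.finite_adjoinRoot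
  have hχ : eval₂ lam₀.value c₀ F = 0 := by rw [← hc₀, fiber, Polynomial.eval_map]
  let χ : AdjoinRoot F →+* K := AdjoinRoot.lift lam₀.value c₀ hχ
  have : Nontrivial (AdjoinRoot F) := χ.domain_nontrivial
  let ψ : Γ(Λ, ⊤) ⟶ .of (AdjoinRoot F) :=
    CommRingCat.ofHom (algebraMap Γ(Λ, ⊤) (AdjoinRoot F))
  have h1 : IsFinite (Spec.map ψ) := by
    rw [IsFinite.SpecMap_iff]
    exact RingHom.finite_algebraMap.mpr hfin
  have h2 : Flat (Spec.map ψ) := by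
    rw [Flat.SpecMap_iff]
    exact RingHom.flat_algebraMap_iff.mpr inferInstance
  have h3 : LocallyOfFinitePresentation (Spec.map ψ) := by
    rw [HasRingHomProperty.Spec_iff (P := @LocallyOfFinitePresentation)]
    have := Module.finitePresentation_of_projective Γ(Λ, ⊤) (AdjoinRoot F)
    exact RingHom.finitePresentation_algebraMap.mpr
      (Algebra.FinitePresentation.of_finitePresentation Γ(Λ, ⊤) (AdjoinRoot F))
  have h4 : Surjective (Spec.map ψ) := ⟨PrimeSpectrum.comap_surjective_of_faithfullyFlat⟩
  let Y := Limits.pullback Λ.toSpecΓ (Spec.map ψ)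
  let p : Y ⟶ Λ := Limits.pullback.fst Λ.toSpecΓ (Spec.map ψ)
  let ι := Y.nilradical.subschemeι
  have hιs : Surjective ι := surjective_subschemeι_nilradical Y
  have hY : UniversallyOpen p := inferInstance
  have hι : UniversallyOpen ι := universallyOpen_of_isClosedImmersion ι
  have hopen : UniversallyOpen (ι ≫ p) := inferInstance
  -- the tautological root
  let cY : Γ(Y, ⊤) := (Limits.pullback.snd Λ.toSpecΓ (Spec.map ψ)).appTop
    ((Scheme.ΓSpecIso (.of (AdjoinRoot F))).inv (AdjoinRoot.root F))
  have hcY : eval₂ p.appTop.hom cY F = 0 := by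
    have hp : p.appTop.hom = (((Scheme.ΓSpecIso (.of (AdjoinRoot F))).inv ≫
        (Limits.pullback.snd Λ.toSpecΓ (Spec.map ψ)).appTop).hom).comp (AdjoinRoot.of F) := by
      have := congrArg Scheme.Hom.appTop (Limits.pullback.condition (f := Λ.toSpecΓ)
        (g := Spec.map ψ))
      rw [Scheme.Hom.comp_appTop, Scheme.Hom.comp_appTop, Scheme.toSpecΓ_appTop] at this
      have := congrArg (fun f => (Scheme.ΓSpecIso Γ(Λ, ⊤)).inv ≫ f) this
      simp only [Iso.inv_hom_id_assoc, ← Scheme.ΓSpecIso_inv_naturality_assoc] at this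
      exact congrArg CommRingCat.Hom.hom this
    rw [hp]
    have := congrArg ((Scheme.ΓSpecIso (.of (AdjoinRoot F))).inv ≫
        (Limits.pullback.snd Λ.toSpecΓ (Spec.map ψ)).appTop).hom (AdjoinRoot.eval₂_root F)
    rwa [hom_eval₂, map_zero] at this
  let y : Spec (.of K) ⟶ Y := Limits.pullback.lift lam₀.1 (Spec.map (CommRingCat.ofHom χ)) (by
    rw [Scheme.toSpecΓ_naturality, ← Spec.map_comp, ← SpecMap_ΓSpecIso_hom, ← Spec.map_comp]
    congr 1
    ext g
    exact (AdjoinRoot.lift_of hχ).symm)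
  have hyp : y ≫ p = lam₀.1 := Limits.pullback.lift_fst _ _ _
  have hyc : valueAt y cY = c₀ := by
    rw [← valueAt_comp, Limits.pullback.lift_snd, valueAt_SpecMap]
    exact AdjoinRoot.lift_root hχ
  obtain ⟨x₀, hx₀⟩ : ∃ x : Pt ((ι ≫ p) ≫ s), x.1 ≫ ι = y := by
    have hys : y ≫ p ≫ s = 𝟙 _ := by rw [← Category.assoc, hyp, lam₀.2]
    obtain ⟨x, hx⟩ := exists_pt_comp_eq ι (p ≫ s) y hys
    exact ⟨⟨x, by rw [Category.assoc, ← Category.assoc, hx, hys]⟩, hx⟩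
  refine ⟨_, ι ≫ p, x₀, ι.appTop cY, isReduced_subscheme_nilradical Y, inferInstance,
    inferInstance, hopen, ?_, ?_, ?_⟩
  · refine Subtype.ext ?_
    change x₀.1 ≫ ι ≫ p = _
    rw [← Category.assoc, hx₀, hyp]
  · change valueAt x₀.1 (ι.appTop cY) = c₀
    rw [← valueAt_comp, hx₀, hyc]
  · have := congrArg ι.appTop.hom hcY
    rw [hom_eval₂, map_zero] at this
    rw [← this, Scheme.Hom.comp_appTop]
    rfl

/-! ### Base change and translation of the affine line -/

section CoordinateChange

variable {K : Type u} [Field K] {Λ Λ' : Scheme.{u}} {s : Λ ⟶ Spec (.of K)}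

theorem LinePt.hom_injective : Function.Injective (LinePt.hom (s := s)) := by
  intro p p' h
  refine LinePt.ext (Subtype.ext ?_) ?_
  · rw [← p.hom_over, h, p'.hom_over]
  · rw [← p.valueAt_coord PUnit.unit, h, p'.valueAt_coord]

/-- The map `(lam', y) ↦ (π lam', y + c(lam'))` from `Λ' × 𝔸¹` to `Λ × 𝔸¹`. -/
noncomputable def shift (s : Λ ⟶ Spec (.of K)) (π : Λ' ⟶ Λ) (c : Γ(Λ', ⊤))
    (p : LinePt (π ≫ s)) : LinePt s :=
  ⟨p.lam.map s π, p.z + p.lam.value c⟩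

/-- The translation of `𝔸¹_Λ` by a regular function on `Λ`. -/
noncomputable def translation (c : Γ(Λ, ⊤)) : 𝔸(PUnit.{u + 1}; Λ) ⟶ 𝔸(PUnit.{u + 1}; Λ) :=
  AffineSpace.homOfVector (𝔸(PUnit.{u + 1}; Λ) ↘ Λ)
    (fun i => AffineSpace.coord Λ i + (𝔸(PUnit.{u + 1}; Λ) ↘ Λ).appTop c)

theorem translation_over (c : Γ(Λ, ⊤)) :
    translation c ≫ 𝔸(PUnit.{u + 1}; Λ) ↘ Λ = 𝔸(PUnit.{u + 1}; Λ) ↘ Λ :=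
  AffineSpace.homOfVector_over _ _

theorem translation_appTop_coord (c : Γ(Λ, ⊤)) (i : PUnit) :
    (translation c).appTop (AffineSpace.coord Λ i) =
      AffineSpace.coord Λ i + (𝔸(PUnit.{u + 1}; Λ) ↘ Λ).appTop c :=
  AffineSpace.homOfVector_appTop_coord _ _ _

theorem translation_comp_neg (c : Γ(Λ, ⊤)) : translation c ≫ translation (-c) = 𝟙 _ := by
  refine AffineSpace.hom_ext ?_ fun i => ?_
  · rw [Category.assoc, translation_over, translation_over, Category.id_comp]
  · have h : (translation c).appTop ((𝔸(PUnit.{u + 1}; Λ) ↘ Λ).appTop c) =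
        (𝔸(PUnit.{u + 1}; Λ) ↘ Λ).appTop c := by
      conv_rhs => rw [← translation_over c]
      rw [Scheme.Hom.comp_appTop]
      rfl
    rw [Scheme.Hom.comp_appTop, CommRingCat.comp_apply, translation_appTop_coord, map_add,
      translation_appTop_coord, map_neg, map_neg, h, add_neg_cancel_right]
    simp

instance (c : Γ(Λ, ⊤)) : IsIso (translation c) :=
  ⟨translation (-c), translation_comp_neg c, by simpa using translation_comp_neg (-c)⟩

theorem shift_hom (π : Λ' ⟶ Λ) (c : Γ(Λ', ⊤)) (p : LinePt (π ≫ s)) :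
    (shift s π c p).hom = p.hom ≫ translation c ≫ AffineSpace.map PUnit.{u + 1} π := by
  apply hom_ext_of_valueAt
  · rw [LinePt.hom_over, Category.assoc, Category.assoc, AffineSpace.map_over,
      reassoc_of% (translation_over c), reassoc_of% p.hom_over]
    rfl
  · rw [LinePt.valueAt_coord, valueAt_comp, Scheme.Hom.comp_appTop, CommRingCat.comp_apply,
      AffineSpace.map_appTop_coord, translation_appTop_coord, map_add, p.valueAt_coord,
      ← valueAt_comp, p.hom_over]
    rfl

theorem continuous_shift (π : Λ' ⟶ Λ) (c : Γ(Λ', ⊤)) : Continuous (shift s π c) := by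
  rw [continuous_induced_rng]
  have : LinePt.toScheme ∘ shift s π c =
      (translation c ≫ AffineSpace.map PUnit.{u + 1} π) ∘ LinePt.toScheme := by
    ext p
    change (shift s π c p).hom _ = _
    rw [shift_hom]
    rfl
  rw [this]
  exact (Scheme.Hom.continuous _).comp LinePt.continuous_toScheme

/-- Openness on schemes passes to `K`-points since closed points of the fibres over `K`-points are
`K`-points. -/
theorem isOpenMap_shift [IsAlgClosed K] [LocallyOfFiniteType s] (π : Λ' ⟶ Λ)
    [LocallyOfFiniteType π] [UniversallyOpen π] (c : Γ(Λ', ⊤)) : IsOpenMap (shift s π c) := by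
  set Q := translation c ≫ AffineSpace.map PUnit.{u + 1} π with hQ
  have h1 : UniversallyOpen (AffineSpace.map PUnit.{u + 1} π) :=
    MorphismProperty.of_isPullback (AffineSpace.isPullback_map π).flip inferInstance
  have hopen : UniversallyOpen Q := inferInstance
  intro U hU
  obtain ⟨V, hV, rfl⟩ := isOpen_induced_iff.mp hU
  refine isOpen_induced_iff.mpr ⟨Q '' V, Q.isOpenMap V hV, ?_⟩
  ext p
  constructor
  · rintro ⟨v, hv, hvp⟩
    have hJ : JacobsonSpace 𝔸(PUnit.{u + 1}; Λ') :=
      LocallyOfFiniteType.jacobsonSpace (𝔸(PUnit.{u + 1}; Λ') ↘ Λ' ≫ π ≫ s)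
    have hpc : IsClosed {p.toScheme} :=
      (pointEquivClosedPoint (𝔸(PUnit.{u + 1}; Λ) ↘ Λ ≫ s) ⟨p.hom, p.hom_comp⟩).2
    -- the fibre of `Q` over `p` meets `V` in a locally closed set, which has a closed point
    obtain ⟨y, ⟨hyV, hyp⟩, hy⟩ := nonempty_inter_closedPoints (Z := V ∩ Q ⁻¹' {p.toScheme})
      ⟨v, hv, hvp⟩ (hV.isLocallyClosed.inter (hpc.preimage Q.continuous).isLocallyClosed)
    obtain ⟨p', hp'⟩ := LinePt.exists_hom_eq (s := π ≫ s)
      (pointOfClosedPoint (𝔸(PUnit.{u + 1}; Λ') ↘ Λ' ≫ π ≫ s) y hy)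
      (pointOfClosedPoint_comp _ _ _)
    have hp'y : p'.toScheme = y := by
      rw [LinePt.toScheme_eq, hp']
      exact pointOfClosedPoint_apply _ _ _ _
    refine ⟨p', ?_, LinePt.hom_injective ?_⟩
    · change p'.toScheme ∈ V
      rwa [hp'y]
    · refine ext_of_apply_closedPoint_eq (𝔸(PUnit.{u + 1}; Λ) ↘ Λ ≫ s) (LinePt.hom_comp _)
        (LinePt.hom_comp _) ?_
      rw [shift_hom]
      change Q (p'.toScheme) = p.toScheme
      rw [hp'y]
      exact hyp
  · rintro ⟨p', hp', rfl⟩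
    refine ⟨p'.toScheme, hp', ?_⟩
    change Q (p'.hom _) = (shift s π c p').hom _
    rw [shift_hom]
    rfl

/-- A finite surjective open morphism maps irreducible components onto irreducible components. -/
theorem image_mem_irreducibleComponents {T T' : Type*} [TopologicalSpace T] [TopologicalSpace T']
    [TopologicalSpace.NoetherianSpace T'] {f : T' → T} (hf : Continuous f) (hfo : IsOpenMap f)
    (hfc : IsClosedMap f) {W : Set T'} (hW : W ∈ irreducibleComponents T') :
    f '' W ∈ irreducibleComponents T := by
  have hWi : IsIrreducible W := hW.1
  refine ⟨hWi.image f hf.continuousOn, fun Y hY hWY => ?_⟩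
  obtain ⟨o, ho, ⟨x, hx⟩, hoW⟩ :=
    TopologicalSpace.NoetherianSpace.exists_isOpen_nonempty_subset_irreducibleComponent W hW
  refine (subset_closure_inter_of_isPreirreducible_of_isOpen hY.isPreirreducible (hfo o ho)
    ⟨f x, hWY ⟨x, hoW hx, rfl⟩, x, hx, rfl⟩).trans ?_
  refine (hfc W (isClosed_of_mem_irreducibleComponents W hW)).closure_subset_iff.mpr ?_
  exact Set.inter_subset_right.trans (Set.image_mono hoW)

end CoordinateChange

/-! ### Iterates in a family -/

section Iterates

theorem eval₂_iter {A B : Type*} [CommRing A] [CommRing B] (φ : A →+* B) (P : A[X]) (n : ℕ)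
    (x : B) : eval₂ φ x (iter P n) = (fun t => eval₂ φ t P)^[n] x := by
  induction n with
  | zero => simp [iter]
  | succ n ih =>
    rw [Function.iterate_succ_apply', ← ih, iter, Function.iterate_succ_apply', eval₂_comp]
    rfl

theorem eval_fiber_iter {K : Type u} [Field K] {Λ : Scheme.{u}} {s : Λ ⟶ Spec (.of K)}
    (P : Γ(Λ, ⊤)[X]) (n : ℕ) (x : Pt s) (z : K) :
    (fiber (iter P n) x).eval z = (fun t => (fiber P x).eval t)^[n] z := by
  rw [fiber, Polynomial.eval_map, eval₂_iter]
  congr 1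
  ext t
  rw [fiber, Polynomial.eval_map]

variable {K : Type u} [Field K] [IsAlgClosed K] [CharZero K] {Λ : Scheme.{u}}
  (s : Λ ⟶ Spec (.of K)) [LocallyOfFiniteType s]

/-- On an irreducible closed subset of the preperiodic locus, preperiodicity is uniform. -/
theorem exists_iterate_eq_of_subset_preper (P : Γ(Λ, ⊤)[X]) (hd : 2 ≤ P.natDegree)
    (hP : IsUnit P.leadingCoeff) (Z : TopologicalSpace.IrreducibleCloseds (LinePt s))
    (hZ : (Z : Set (LinePt s)) ⊆ preper s P) :
    ∃ a b : ℕ, a < b ∧ ∀ p ∈ (Z : Set (LinePt s)),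
      (fun t => (fiber P p.lam).eval t)^[a] p.z = (fun t => (fiber P p.lam).eval t)^[b] p.z := by
  have hE : IsIrreducible (LinePt.toScheme '' (Z : Set (LinePt s))) :=
    Z.isIrreducible.image _ LinePt.continuous_toScheme.continuousOn
  set η := hE.genericPoint
  have hη : closure {η} = closure (LinePt.toScheme '' (Z : Set (LinePt s))) :=
    hE.isGenericPoint_genericPoint_closure
  -- an affine chart containing the generic point of `Z`
  obtain ⟨R, j, hj, y, hy⟩ := Scheme.exists_Spec_apply_eq η
  obtain ⟨φ, hφ⟩ := Spec.map_surjective (j ≫ 𝔸(PUnit.{u + 1}; Λ) ↘ Λ ≫ s)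
  have hφfin : φ.hom.FiniteType := by
    rw [← HasRingHomProperty.Spec_iff (P := @LocallyOfFiniteType), hφ]
    infer_instance
  let B := R ⧸ y.asIdeal
  have hyp : y.asIdeal.IsPrime := y.2
  let mk : R →+* B := Ideal.Quotient.mk y.asIdeal
  let : Algebra K B := (mk.comp φ.hom).toAlgebra
  have : Algebra.FiniteType K B :=
    (hφfin.comp_surjective Ideal.Quotient.mk_surjective : (mk.comp φ.hom).FiniteType)
  let θ : Γ(𝔸(PUnit.{u + 1}; Λ), ⊤) →+* B := mk.comp ((Scheme.ΓSpecIso R).hom.hom.comp j.appTop.hom)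
  let zB : B := θ (AffineSpace.coord Λ PUnit.unit)
  let θΛ : Γ(Λ, ⊤) →+* B := θ.comp (𝔸(PUnit.{u + 1}; Λ) ↘ Λ).appTop.hom
  have hu : θΛ P.leadingCoeff ≠ 0 := (hP.map θΛ).ne_zero
  -- every `K`-point of `B` is a point of `Z`
  have hpt : ∀ χ : B →ₐ[K] K, ∃ p ∈ (Z : Set (LinePt s)), ∀ g, χ (θ g) = valueAt p.hom g := by
    intro χ
    let x : Spec (.of K) ⟶ 𝔸(PUnit.{u + 1}; Λ) :=
      Spec.map (CommRingCat.ofHom (χ.toRingHom.comp mk)) ≫ j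
    have hx : x ≫ 𝔸(PUnit.{u + 1}; Λ) ↘ Λ ≫ s = 𝟙 _ := by
      rw [Category.assoc, ← hφ, ← Spec.map_comp, ← Spec.map_id]
      congr 1
      ext a
      exact χ.commutes a
    obtain ⟨p, hp⟩ := LinePt.exists_hom_eq x hx
    refine ⟨p, ?_, fun g => ?_⟩
    · obtain ⟨C, hC, hCZ⟩ := isClosed_induced_iff.mp Z.isClosed
      have h1 : p.toScheme ∈ closure {η} := by
        rw [LinePt.toScheme_eq, hp]
        have h2 : y ⤳ Spec.map (CommRingCat.ofHom (χ.toRingHom.comp mk))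
            (IsLocalRing.closedPoint K) := by
          refine (PrimeSpectrum.le_iff_specializes _ _).mp fun r hr => ?_
          change χ (mk r) ∈ IsLocalRing.maximalIdeal K
          rw [Ideal.Quotient.eq_zero_iff_mem.mpr hr, map_zero]
          exact zero_mem _
        exact (hy ▸ h2.map j.continuous).mem_closure
      rw [hη] at h1
      have h2 : closure (LinePt.toScheme '' (Z : Set (LinePt s))) ⊆ C := by
        refine hC.closure_subset_iff.mpr ?_
        rintro _ ⟨p', hp', rfl⟩
        rw [← hCZ] at hp'
        exact hp'
      rw [← hCZ]
      exact h2 h1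
    · rw [hp, valueAt_comp]
      exact (valueAt_SpecMap' (CommRingCat.ofHom (χ.toRingHom.comp mk)) (j.appTop g)).symm
  obtain ⟨a, b, hab, h⟩ := exists_iterate_eq_of_forall_algHom (K := K) (P.map θΛ)
    (by rwa [natDegree_map_of_leadingCoeff_ne_zero _ hu])
    (by rw [leadingCoeff_map_of_leadingCoeff_ne_zero _ hu]; exact hP.map θΛ) zB (fun χ => by
      obtain ⟨p, hp, hχ⟩ := hpt χ
      have h1 : χ zB = p.z := (hχ _).trans (p.valueAt_coord _)
      have h2 : (P.map θΛ).map χ.toRingHom = fiber P p.lam := by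
        rw [Polynomial.map_map, fiber]
        congr 1
        ext g
        refine (hχ _).trans ?_
        change valueAt p.hom ((𝔸(PUnit.{u + 1}; Λ) ↘ Λ).appTop g) = _
        rw [← valueAt_comp, p.hom_over]
        rfl
      rw [h1, h2]
      exact hZ hp)
  refine ⟨a, b, hab, ?_⟩
  have hiter : ∀ n, θ (lineFun (iter P n)) = (fun t => (P.map θΛ).eval t)^[n] zB := fun n => by
    rw [lineFun, hom_eval₂]
    change eval₂ θΛ zB _ = _
    rw [eval₂_iter]
    congr 1
    ext t
    rw [Polynomial.eval_map]
  have hzero : θ (lineFun (iter P a - iter P b)) = 0 := by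
    rw [lineFun, eval₂_sub, map_sub, sub_eq_zero]
    exact (hiter a).trans (h.trans (hiter b).symm)
  have hηn : η ∉ 𝔸(PUnit.{u + 1}; Λ).basicOpen (lineFun (iter P a - iter P b)) := by
    rw [← hy]
    intro hmem
    have h1 : y ∈ (Spec R).basicOpen (j.appTop (lineFun (iter P a - iter P b))) := by
      rw [← Scheme.preimage_basicOpen_top]
      exact hmem
    rw [basicOpen_eq_of_affine'] at h1
    exact h1 (Ideal.Quotient.eq_zero_iff_mem.mp hzero)
  intro p hp
  have hsp : p.toScheme ∉ 𝔸(PUnit.{u + 1}; Λ).basicOpen (lineFun (iter P a - iter P b)) := by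
    intro hmem
    have h1 : η ⤳ p.toScheme := by
      rw [specializes_iff_mem_closure, hη]
      exact subset_closure ⟨p, hp, rfl⟩
    exact hηn (h1.mem_open (TopologicalSpace.Opens.isOpen _) hmem)
  rw [LinePt.toScheme_eq, mem_basicOpen_iff, not_not, LinePt.valueAt_lineFun, fiber,
    Polynomial.map_sub, eval_sub, sub_eq_zero] at hsp
  rw [← eval_fiber_iter, ← eval_fiber_iter]
  exact hsp

end Iterates

/-! ### Dynamics near a fixed point over a domain -/

section Local

variable {B K : Type*} [CommRing B] [Field K] (ε : B →+* K) (f : B[X])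

theorem map_iterate_eval (n : ℕ) (x : B) :
    ε ((fun t => f.eval t)^[n] x) = (fun t => (f.map ε).eval t)^[n] (ε x) := by
  refine Function.Semiconj.iterate_right (f := ε) (fun t => ?_) n x
  exact (eval_map_apply ε t).symm

variable {c₀ : K}

theorem map_iterate_eval_of_fixed (hf : (f.map ε).eval c₀ = c₀) {x : B} (hx : ε x = c₀) (n : ℕ) :
    ε ((fun t => f.eval t)^[n] x) = c₀ := by
  rw [map_iterate_eval, hx]
  exact Function.iterate_fixed hf n

/-- The difference of the values of an iterate at two points specializing to the same fixed point
is a multiple of the difference of the points; the factor specializes to a power of the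
multiplier. -/
theorem exists_iterate_sub_eq (hf : (f.map ε).eval c₀ = c₀) {x y : B} (hx : ε x = c₀)
    (hy : ε y = c₀) (n : ℕ) :
    ∃ e, (fun t => f.eval t)^[n] x - (fun t => f.eval t)^[n] y = (x - y) * e ∧
      ε e = (f.map ε).derivative.eval c₀ ^ n := by
  induction n with
  | zero => exact ⟨1, by simp, by simp⟩
  | succ n ih =>
    obtain ⟨e, he, hee⟩ := ih
    set x' := (fun t => f.eval t)^[n] x
    set y' := (fun t => f.eval t)^[n] y
    have hx' : ε x' = c₀ := map_iterate_eval_of_fixed ε f hf hx n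
    have hy' : ε y' = c₀ := map_iterate_eval_of_fixed ε f hf hy n
    obtain ⟨k, hk⟩ := f.binomExpansion y' (x' - y')
    refine ⟨e * (f.derivative.eval y' + k * (x' - y')), ?_, ?_⟩
    · rw [Function.iterate_succ_apply', Function.iterate_succ_apply', ← mul_assoc, ← he]
      rw [add_sub_cancel] at hk
      change f.eval x' - f.eval y' = _
      rw [hk]
      ring
    · rw [map_mul, hee, map_add, map_mul, map_sub, hx', hy', sub_self, mul_zero, add_zero,
        pow_succ, derivative_map, ← hy', eval_map_apply]

variable [IsDomain B]

/-- Near a fixed point whose multiplier is not a root of unity other than `1`, every periodic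
point is fixed: `f^l(x) - x` is `f(x) - x` times a sum of `l` factors specializing to the powers of
the multiplier. -/
theorem eval_eq_self_of_iterate_eq (hf : (f.map ε).eval c₀ = c₀)
    (hμ : ∀ l, 1 ≤ l → ∑ i ∈ Finset.range l, (f.map ε).derivative.eval c₀ ^ i ≠ 0)
    {x : B} (hx : ε x = c₀) {l : ℕ} (hl : 1 ≤ l) (h : (fun t => f.eval t)^[l] x = x) :
    f.eval x = x := by
  have hfx : ε (f.eval x) = c₀ := map_iterate_eval_of_fixed ε f hf hx 1
  choose e he hee using exists_iterate_sub_eq ε f hf hfx hx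
  have hsum : ∀ n, (fun t => f.eval t)^[n] x - x =
      (f.eval x - x) * ∑ i ∈ Finset.range n, e i := by
    intro n
    induction n with
    | zero => simp
    | succ n ih =>
      rw [Finset.sum_range_succ, mul_add, ← ih, ← he n, ← Function.iterate_succ_apply]
      ring
  have h0 := hsum l
  rw [h, sub_self, eq_comm, mul_eq_zero] at h0
  refine sub_eq_zero.mp (h0.resolve_right fun h1 => hμ l hl ?_)
  have := congrArg ε h1
  rwa [map_sum, map_zero, Finset.sum_congr rfl fun i _ => hee i] at this

/-- Near a fixed point whose multiplier is not `1` there is at most one fixed point. -/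
theorem eq_of_eval_eq_self (hf : (f.map ε).eval c₀ = c₀)
    (hμ : (f.map ε).derivative.eval c₀ ≠ 1) {x y : B} (hx : ε x = c₀) (hy : ε y = c₀)
    (hfx : f.eval x = x) (hfy : f.eval y = y) : x = y := by
  obtain ⟨e, he, hee⟩ := exists_iterate_sub_eq ε f hf hx hy 1
  rw [Function.iterate_one, hfx, hfy, pow_one] at *
  have : (x - y) * (1 - e) = 0 := by rw [mul_sub, mul_one, ← he, sub_self]
  refine sub_eq_zero.mp ((mul_eq_zero.mp this).resolve_right fun h1 => hμ ?_)
  rw [← hee, ← sub_eq_zero.mp h1, map_one]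

/-- Near a fixed point whose multiplier is not zero, iterates are injective. -/
theorem eq_of_iterate_eq (hf : (f.map ε).eval c₀ = c₀)
    (hμ : (f.map ε).derivative.eval c₀ ≠ 0) {x y : B} (hx : ε x = c₀) (hy : ε y = c₀) (n : ℕ)
    (h : (fun t => f.eval t)^[n] x = (fun t => f.eval t)^[n] y) : x = y := by
  obtain ⟨e, he, hee⟩ := exists_iterate_sub_eq ε f hf hx hy n
  rw [h, sub_self, eq_comm, mul_eq_zero] at he
  refine sub_eq_zero.mp (he.resolve_right ?_)
  rintro rfl
  exact pow_ne_zero n hμ (by rw [← hee, map_zero])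

/-- If the local degree of `f` at `0` does not jump at the special point, then `0` is, near the
special point, its only preimage under the iterates of `f`. -/
theorem eq_zero_of_iterate_eq_zero {e : ℕ} (he : 1 ≤ e) (h0 : ∀ j < e, f.coeff j = 0)
    (hfe : ε (f.coeff e) ≠ 0) {y : B} (hy : ε y = 0) (n : ℕ)
    (h : (fun t => f.eval t)^[n] y = 0) : y = 0 := by
  obtain ⟨g, rfl⟩ := X_pow_dvd_iff.mpr h0
  have hfix : ((X ^ e * g).map ε).eval 0 = 0 := by
    simp [zero_pow (by omega : e ≠ 0)]
  induction n with
  | zero => exact h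
  | succ n ih =>
    refine ih ?_
    rw [Function.iterate_succ_apply'] at h
    set y' := (fun t => (X ^ e * g).eval t)^[n] y
    have hy' : ε y' = 0 := map_iterate_eval_of_fixed ε _ hfix hy n
    simp only [eval_mul, eval_pow, eval_X, mul_eq_zero] at h
    refine pow_eq_zero_iff (by omega) |>.mp (h.resolve_right fun hg => hfe ?_)
    have hc : (X ^ e * g).coeff e = g.coeff 0 := by simpa using coeff_X_pow_mul g e 0
    rw [hc, coeff_zero_eq_eval_zero, ← eval_map_apply, map_zero]
    have h2 := eval_map_apply (p := g) ε y'
    rwa [hy', hg, map_zero] at h2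

end Local

/-! ### Regular functions on an irreducible set -/

section Vanishing

variable {K : Type u} [Field K] {Λ : Scheme.{u}} {s : Λ ⟶ Spec (.of K)}

/-- Evaluation at a point of `Λ × 𝔸¹`. -/
noncomputable def LinePt.evalHom (p : LinePt s) : Γ(Λ, ⊤)[X] →+* K :=
  eval₂RingHom p.lam.value p.z

theorem LinePt.evalHom_apply (p : LinePt s) (G : Γ(Λ, ⊤)[X]) :
    p.evalHom G = (fiber G p.lam).eval p.z := by
  rw [fiber, Polynomial.eval_map]; rfl

/-- The ideal of the polynomials vanishing on a set of points of `Λ × 𝔸¹`. -/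
noncomputable def vanishing (Z : Set (LinePt s)) : Ideal Γ(Λ, ⊤)[X] :=
  ⨅ p ∈ Z, RingHom.ker (LinePt.evalHom p)

theorem mem_vanishing {Z : Set (LinePt s)} {G : Γ(Λ, ⊤)[X]} :
    G ∈ vanishing Z ↔ ∀ p ∈ Z, (fiber G p.lam).eval p.z = 0 := by
  simp [vanishing, RingHom.mem_ker, LinePt.evalHom_apply]

theorem isPrime_vanishing {Z : Set (LinePt s)} (hZ : IsIrreducible Z) : (vanishing Z).IsPrime := by
  refine ⟨?_, fun {G H} h => ?_⟩
  · obtain ⟨p, hp⟩ := hZ.nonempty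
    rw [Ne, Ideal.eq_top_iff_one, mem_vanishing]
    exact fun h => one_ne_zero (α := K) (by simpa [fiber] using h p hp)
  · have hcl : ∀ G : Γ(Λ, ⊤)[X], IsClosed {p : LinePt s | (fiber G p.lam).eval p.z = 0} :=
      isClosed_eval_eq_zero
    have := isPreirreducible_iff_isClosed_union_isClosed.mp hZ.isPreirreducible _ _ (hcl G) (hcl H)
      fun p hp => by
        have := mem_vanishing.mp h p hp
        rwa [fiber, Polynomial.map_mul, eval_mul, mul_eq_zero] at this
    exact this.imp (fun h => mem_vanishing.mpr h) fun h => mem_vanishing.mpr h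

/-- A polynomial vanishing on a nonempty open subset of an irreducible set vanishes on the set. -/
theorem mem_vanishing_of_inter {Z U : Set (LinePt s)} (hZ : IsIrreducible Z) (hU : IsOpen U)
    (hne : (Z ∩ U).Nonempty) {G : Γ(Λ, ⊤)[X]}
    (h : ∀ p ∈ Z ∩ U, (fiber G p.lam).eval p.z = 0) : G ∈ vanishing Z :=
  mem_vanishing.mpr ((subset_closure_inter_of_isPreirreducible_of_isOpen hZ.isPreirreducible hU
    hne).trans ((isClosed_eval_eq_zero G).closure_subset_iff.mpr h))

/-- The ring of the functions on `Z` given by polynomials over the regular functions on `Λ`. -/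
abbrev FunOn (Z : Set (LinePt s)) : Type u := Γ(Λ, ⊤)[X] ⧸ vanishing Z

/-- The value at `p ∈ Z` of a function on `Z`. -/
noncomputable def FunOn.eval {Z : Set (LinePt s)} {p : LinePt s} (hp : p ∈ Z) : FunOn Z →+* K :=
  Ideal.Quotient.lift _ p.evalHom fun G hG => by
    rw [p.evalHom_apply]
    exact mem_vanishing.mp hG p hp

/-- The restriction to `Z` of a polynomial over the regular functions on `Λ`. -/
noncomputable def FunOn.mk (Z : Set (LinePt s)) : Γ(Λ, ⊤)[X] →+* FunOn Z :=
  Ideal.Quotient.mk _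

/-- A family of polynomials, as a polynomial over the ring of functions on `Z`. -/
noncomputable def FunOn.poly (Z : Set (LinePt s)) (Q : Γ(Λ, ⊤)[X]) : (FunOn Z)[X] :=
  Q.map ((FunOn.mk Z).comp Polynomial.C)

variable {Z : Set (LinePt s)}

theorem FunOn.eval_mk {p : LinePt s} (hp : p ∈ Z) (G : Γ(Λ, ⊤)[X]) :
    FunOn.eval hp (FunOn.mk Z G) = (fiber G p.lam).eval p.z :=
  p.evalHom_apply G

theorem FunOn.map_poly {p : LinePt s} (hp : p ∈ Z) (Q : Γ(Λ, ⊤)[X]) :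
    (FunOn.poly Z Q).map (FunOn.eval hp) = fiber Q p.lam := by
  rw [FunOn.poly, Polynomial.map_map, fiber]
  congr 1
  ext g
  change FunOn.eval hp (FunOn.mk Z (Polynomial.C g)) = _
  rw [FunOn.eval_mk, fiber, Polynomial.map_C, eval_C]

theorem FunOn.ext {x y : FunOn Z} (h : ∀ p (hp : p ∈ Z), FunOn.eval hp x = FunOn.eval hp y) :
    x = y := by
  obtain ⟨G, rfl⟩ := Ideal.Quotient.mk_surjective x
  obtain ⟨H, rfl⟩ := Ideal.Quotient.mk_surjective y
  rw [Ideal.Quotient.eq, mem_vanishing]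
  intro p hp
  have := h p hp
  rw [← sub_eq_zero, ← map_sub, ← map_sub] at this
  rw [← FunOn.eval_mk hp]
  exact this

theorem FunOn.eval_iterate {p : LinePt s} (hp : p ∈ Z) (Q W : Γ(Λ, ⊤)[X]) (n : ℕ) :
    FunOn.eval hp ((fun t => (FunOn.poly Z Q).eval t)^[n] (FunOn.mk Z W)) =
      (fun t => (fiber Q p.lam).eval t)^[n] ((fiber W p.lam).eval p.z) := by
  rw [map_iterate_eval, FunOn.map_poly, FunOn.eval_mk]

theorem FunOn.eval_eval_mk {p : LinePt s} (hp : p ∈ Z) (Q W : Γ(Λ, ⊤)[X]) :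
    FunOn.eval hp ((FunOn.poly Z Q).eval (FunOn.mk Z W)) =
      (fiber Q p.lam).eval ((fiber W p.lam).eval p.z) :=
  FunOn.eval_iterate hp Q W 1

/-- Pointwise form of `eval_eq_self_of_iterate_eq` on an irreducible subset of `Λ × 𝔸¹`: a function
`W` on it with value `c₀` at `p₀` that is periodic for the family `Q` is fixed. -/
theorem eval_eq_self_on (hZ : IsIrreducible Z) {p₀ : LinePt s} (hp₀ : p₀ ∈ Z)
    (Q W : Γ(Λ, ⊤)[X]) {c₀ : K} (hW : (fiber W p₀.lam).eval p₀.z = c₀)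
    (hc : (fiber Q p₀.lam).eval c₀ = c₀)
    (hμ : ∀ l, 1 ≤ l →
      ∑ i ∈ Finset.range l, (fiber Q p₀.lam).derivative.eval c₀ ^ i ≠ 0)
    {l : ℕ} (hl : 1 ≤ l)
    (h : ∀ p ∈ Z, (fun t => (fiber Q p.lam).eval t)^[l] ((fiber W p.lam).eval p.z) =
      (fiber W p.lam).eval p.z) :
    ∀ p ∈ Z, (fiber Q p.lam).eval ((fiber W p.lam).eval p.z) = (fiber W p.lam).eval p.z := by
  have := isPrime_vanishing hZ
  rw [← FunOn.map_poly hp₀] at hc hμ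
  have key := eval_eq_self_of_iterate_eq (FunOn.eval hp₀) (FunOn.poly Z Q) hc hμ
    ((FunOn.eval_mk hp₀ W).trans hW) hl
    (FunOn.ext fun p hp => by rw [FunOn.eval_iterate, FunOn.eval_mk, h p hp])
  intro p hp
  have := congrArg (FunOn.eval hp) key
  rwa [FunOn.eval_eval_mk, FunOn.eval_mk] at this

/-- Pointwise form of `eq_of_eval_eq_self`. -/
theorem eq_on_of_eval_eq_self (hZ : IsIrreducible Z) {p₀ : LinePt s} (hp₀ : p₀ ∈ Z)
    (Q W₁ W₂ : Γ(Λ, ⊤)[X]) {c₀ : K} (hW₁ : (fiber W₁ p₀.lam).eval p₀.z = c₀)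
    (hW₂ : (fiber W₂ p₀.lam).eval p₀.z = c₀) (hc : (fiber Q p₀.lam).eval c₀ = c₀)
    (hμ : (fiber Q p₀.lam).derivative.eval c₀ ≠ 1)
    (h₁ : ∀ p ∈ Z, (fiber Q p.lam).eval ((fiber W₁ p.lam).eval p.z) = (fiber W₁ p.lam).eval p.z)
    (h₂ : ∀ p ∈ Z, (fiber Q p.lam).eval ((fiber W₂ p.lam).eval p.z) =
      (fiber W₂ p.lam).eval p.z) :
    ∀ p ∈ Z, (fiber W₁ p.lam).eval p.z = (fiber W₂ p.lam).eval p.z := by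
  have := isPrime_vanishing hZ
  rw [← FunOn.map_poly hp₀] at hc hμ
  have key := eq_of_eval_eq_self (FunOn.eval hp₀) (FunOn.poly Z Q) hc hμ
    ((FunOn.eval_mk hp₀ W₁).trans hW₁) ((FunOn.eval_mk hp₀ W₂).trans hW₂)
    (FunOn.ext fun p hp => by rw [FunOn.eval_eval_mk, FunOn.eval_mk, h₁ p hp])
    (FunOn.ext fun p hp => by rw [FunOn.eval_eval_mk, FunOn.eval_mk, h₂ p hp])
  intro p hp
  rw [← FunOn.eval_mk hp, key, FunOn.eval_mk]

/-- Pointwise form of `eq_of_iterate_eq`. -/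
theorem eq_on_of_iterate_eq (hZ : IsIrreducible Z) {p₀ : LinePt s} (hp₀ : p₀ ∈ Z)
    (Q W₁ W₂ : Γ(Λ, ⊤)[X]) {c₀ : K} (hW₁ : (fiber W₁ p₀.lam).eval p₀.z = c₀)
    (hW₂ : (fiber W₂ p₀.lam).eval p₀.z = c₀) (hc : (fiber Q p₀.lam).eval c₀ = c₀)
    (hμ : (fiber Q p₀.lam).derivative.eval c₀ ≠ 0) (n : ℕ)
    (h : ∀ p ∈ Z, (fun t => (fiber Q p.lam).eval t)^[n] ((fiber W₁ p.lam).eval p.z) =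
      (fun t => (fiber Q p.lam).eval t)^[n] ((fiber W₂ p.lam).eval p.z)) :
    ∀ p ∈ Z, (fiber W₁ p.lam).eval p.z = (fiber W₂ p.lam).eval p.z := by
  have := isPrime_vanishing hZ
  rw [← FunOn.map_poly hp₀] at hc hμ
  have key := eq_of_iterate_eq (FunOn.eval hp₀) (FunOn.poly Z Q) hc hμ
    ((FunOn.eval_mk hp₀ W₁).trans hW₁) ((FunOn.eval_mk hp₀ W₂).trans hW₂) n
    (FunOn.ext fun p hp => by rw [FunOn.eval_iterate, FunOn.eval_iterate, h p hp])
  intro p hp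
  rw [← FunOn.eval_mk hp, key, FunOn.eval_mk]

/-- Pointwise form of `eq_zero_of_iterate_eq_zero`. -/
theorem eq_zero_on_of_iterate_eq_zero (hZ : IsIrreducible Z) {p₀ : LinePt s} (hp₀ : p₀ ∈ Z)
    (Q W : Γ(Λ, ⊤)[X]) (hW : (fiber W p₀.lam).eval p₀.z = 0) {e : ℕ} (he : 1 ≤ e)
    (h0 : ∀ j < e, ∀ p ∈ Z, (fiber Q p.lam).coeff j = 0) (hQe : (fiber Q p₀.lam).coeff e ≠ 0)
    (n : ℕ)
    (h : ∀ p ∈ Z, (fun t => (fiber Q p.lam).eval t)^[n] ((fiber W p.lam).eval p.z) = 0) :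
    ∀ p ∈ Z, (fiber W p.lam).eval p.z = 0 := by
  have := isPrime_vanishing hZ
  have key := eq_zero_of_iterate_eq_zero (FunOn.eval hp₀) (FunOn.poly Z Q) he
    (fun j hj => FunOn.ext fun p hp => by
      rw [← Polynomial.coeff_map, FunOn.map_poly, map_zero, h0 j hj p hp])
    (by rwa [← Polynomial.coeff_map, FunOn.map_poly])
    ((FunOn.eval_mk hp₀ W).trans hW) n
    (FunOn.ext fun p hp => by rw [FunOn.eval_iterate, map_zero, h p hp])
  intro p hp
  rw [← FunOn.eval_mk hp, key, map_zero]

end Vanishing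

/-! ### Families of polynomials of constant degree -/

section Family

theorem natDegree_iter {K : Type*} [Field K] (P : K[X]) (n : ℕ) :
    (iter P n).natDegree = P.natDegree ^ n := by
  induction n with
  | zero => simp [iter]
  | succ n ih =>
    have : iter P (n + 1) = P.comp (iter P n) := Function.iterate_succ_apply' _ _ _
    rw [this, natDegree_comp, ih, pow_succ']

theorem map_iter {A B : Type*} [CommRing A] [CommRing B] (φ : A →+* B) (P : A[X]) (n : ℕ) :
    (iter P n).map φ = iter (P.map φ) n := by
  induction n with
  | zero => simp [iter]
  | succ n ih =>
    have h : iter P (n + 1) = P.comp (iter P n) := Function.iterate_succ_apply' _ _ _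
    have h' : iter (P.map φ) (n + 1) = (P.map φ).comp (iter (P.map φ) n) :=
      Function.iterate_succ_apply' _ _ _
    rw [h, h', map_comp, ih]

theorem eval_iter {A : Type*} [CommRing A] (P : A[X]) (n : ℕ) (x : A) :
    (iter P n).eval x = (fun t => P.eval t)^[n] x :=
  eval₂_iter (RingHom.id A) P n x

theorem derivative_iter_eval_of_fixed {A : Type*} [CommRing A] (P : A[X]) {c : A}
    (hc : P.eval c = c) (n : ℕ) :
    (iter P n).derivative.eval c = P.derivative.eval c ^ n := by
  induction n with
  | zero => simp [iter]
  | succ n ih =>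
    have : iter P (n + 1) = P.comp (iter P n) := Function.iterate_succ_apply' _ _ _
    rw [this, derivative_comp, eval_mul, eval_comp, ih, eval_iter,
      Function.iterate_fixed (f := fun t => P.eval t) hc, pow_succ]

variable {K : Type u} [Field K] {Λ : Scheme.{u}} {s : Λ ⟶ Spec (.of K)} {d : ℕ} {P : Γ(Λ, ⊤)[X]}

theorem fiber_iter (n : ℕ) (x : Pt s) : fiber (iter P n) x = iter (fiber P x) n :=
  map_iter _ _ _

theorem IsFamilyOfDegree.natDegree_fiber (hP : IsFamilyOfDegree s d P) (x : Pt s) :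
    (fiber P x).natDegree = d :=
  natDegree_eq_of_degree_eq_some (hP x)

theorem IsFamilyOfDegree.iter_sub_X (hP : IsFamilyOfDegree s d P) (hd : 2 ≤ d) {N : ℕ}
    (hN : 1 ≤ N) : IsFamilyOfDegree s (d ^ N) (iter P N - X) := by
  intro x
  have h1 : (iter (fiber P x) N).natDegree = d ^ N := by
    rw [natDegree_iter, hP.natDegree_fiber]
  have h2 : 1 < d ^ N := Nat.one_lt_pow (by omega) hd
  have h3 : (iter (fiber P x) N).degree = (d ^ N : ℕ) :=
    (degree_eq_iff_natDegree_eq_of_pos (by omega)).mpr h1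
  rw [fiber, Polynomial.map_sub, Polynomial.map_X]
  change (fiber (iter P N) x - X).degree = _
  rw [fiber_iter, degree_sub_eq_left_of_degree_lt, h3]
  rw [h3, degree_X]
  exact_mod_cast h2

variable [IsAlgClosed K] [LocallyOfFiniteType s] [IsReduced Λ]

theorem IsFamilyOfDegree.natDegree_eq (hP : IsFamilyOfDegree s d P) (x : Pt s) :
    P.natDegree = d := by
  refine natDegree_eq_of_le_of_coeff_ne_zero ?_ fun h => ?_
  · refine natDegree_le_iff_coeff_eq_zero.mpr fun n hn => eq_zero_of_forall_value_eq_zero s _ fun y => ?_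
    rw [← Polynomial.coeff_map]
    exact coeff_eq_zero_of_degree_lt ((hP y).trans_lt (by exact_mod_cast hn))
  · have := coeff_ne_zero_of_eq_degree (hP x)
    rw [fiber, Polynomial.coeff_map, h, map_zero] at this
    exact this rfl

theorem IsFamilyOfDegree.isUnit_leadingCoeff (hP : IsFamilyOfDegree s d P) (x : Pt s) :
    IsUnit P.leadingCoeff := by
  refine isUnit_of_forall_value_ne_zero s _ fun y => ?_
  have := coeff_ne_zero_of_eq_degree (hP y)
  rwa [fiber, Polynomial.coeff_map, ← hP.natDegree_eq x] at this

end Family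

/-! ### The coincidence locus of two iterates -/

section Coincidence

variable {K : Type u} [Field K] {Λ : Scheme.{u}} {s : Λ ⟶ Spec (.of K)} {d : ℕ} {P : Γ(Λ, ⊤)[X]}

/-- The locus `{P^a = P^b}` in `Λ × 𝔸¹`. -/
def coincidence (s : Λ ⟶ Spec (.of K)) (P : Γ(Λ, ⊤)[X]) (a b : ℕ) : Set (LinePt s) :=
  {p | (fun t => (fiber P p.lam).eval t)^[a] p.z = (fun t => (fiber P p.lam).eval t)^[b] p.z}

theorem mem_coincidence {a b : ℕ} {p : LinePt s} : p ∈ coincidence s P a b ↔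
    (fun t => (fiber P p.lam).eval t)^[a] p.z = (fun t => (fiber P p.lam).eval t)^[b] p.z :=
  Iff.rfl

theorem isClosed_coincidence (P : Γ(Λ, ⊤)[X]) (a b : ℕ) : IsClosed (coincidence s P a b) := by
  convert isClosed_eval_eq_zero (s := s) (iter P a - iter P b) using 1
  ext p
  change _ = _ ↔ _ = _
  rw [← eval_fiber_iter, ← eval_fiber_iter, ← sub_eq_zero, ← eval_sub, fiber, fiber, fiber,
    Polynomial.map_sub]

theorem interior_coincidence [Infinite K] (hP : IsFamilyOfDegree s d P) (hd : 2 ≤ d) {a b : ℕ}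
    (hab : a ≠ b) : interior (coincidence s P a b) = ∅ := by
  rw [Set.eq_empty_iff_forall_notMem]
  rintro ⟨x, z⟩ hp
  have h1 := finite_vertical_notMem isOpen_interior hp
  have hne : iter (fiber P x) a - iter (fiber P x) b ≠ 0 := by
    intro h
    have := congrArg natDegree (sub_eq_zero.mp h)
    rw [natDegree_iter, natDegree_iter, hP.natDegree_fiber] at this
    exact hab (Nat.pow_right_injective hd this)
  refine Set.infinite_univ (α := K) ((h1.union (finite_setOfPred_isRoot hne)).subset fun w _ => ?_)
  by_cases hw : (⟨x, w⟩ : LinePt s) ∈ interior (coincidence s P a b)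
  · right
    have hw' : (⟨x, w⟩ : LinePt s) ∈ coincidence s P a b := interior_subset hw
    rw [mem_coincidence] at hw'
    change eval w _ = 0
    rw [eval_sub, eval_iter, eval_iter, hw', sub_self]
  · left; exact hw

/-- Only finitely many hypersurfaces are contained in a coincidence locus. -/
theorem exists_not_subset_coincidence [Infinite K] [LocallyOfFiniteType s] [QuasiCompact s]
    (hP : IsFamilyOfDegree s d P) (hd : 2 ≤ d)
    (Z : ℕ → TopologicalSpace.IrreducibleCloseds (LinePt s)) (hinj : Function.Injective Z)
    (hcodim : ∀ i, Order.coheight (Z i) = 1) {a b : ℕ} (hab : a ≠ b) :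
    ∃ i, ¬ (Z i : Set (LinePt s)) ⊆ coincidence s P a b := by
  by_contra! h
  refine Set.infinite_range_of_injective (SetLike.coe_injective.comp hinj)
    ((finite_isComponentOf (isClosed_coincidence (s := s) P a b)).subset ?_)
  rintro _ ⟨i, rfl⟩
  exact isComponentOf_of_coheight_eq_one (Z i) (hcodim i) (isClosed_coincidence P a b)
    (interior_coincidence hP hd hab) (h i)

end Coincidence

/-! ### The choice of the iterate -/

/-- Some iterate of a polynomial fixes a point of the orbit of a given preperiodic point, with
multiplier equal to `1` or not a root of unity. Both cases are expressed by the sums of the powers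
of the multiplier being nonzero. -/
theorem exists_iterate_sum_pow_ne_zero {K : Type*} [Field K] [CharZero K] (g : K[X]) (z₀ : K) {a b : ℕ}
    (hab : a < b) (h : (fun t => g.eval t)^[a] z₀ = (fun t => g.eval t)^[b] z₀) :
    ∃ N k : ℕ, 1 ≤ N ∧ (z₀ ∈ Function.periodicPts (fun t => g.eval t) → k = 0) ∧
      (iter g N).eval ((fun t => g.eval t)^[N * k] z₀) = (fun t => g.eval t)^[N * k] z₀ ∧
      ∀ l, 1 ≤ l → ∑ i ∈ Finset.range l,
        (iter g N).derivative.eval ((fun t => g.eval t)^[N * k] z₀) ^ i ≠ 0 := by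
  set G := fun t => g.eval t
  obtain ⟨N₁, k, hN₁, hk, hc1⟩ : ∃ N₁ k : ℕ, 1 ≤ N₁ ∧ (z₀ ∈ Function.periodicPts G → k = 0) ∧
      (iter g N₁).eval (G^[N₁ * k] z₀) = G^[N₁ * k] z₀ := by
    by_cases hper : z₀ ∈ Function.periodicPts G
    · obtain ⟨n, hn, hz⟩ := hper
      exact ⟨n, 0, hn, fun _ => rfl, by rw [eval_iter]; exact hz⟩
    -- a multiple of the period `b - a` that is at least the preperiod `a`
    · refine ⟨(b - a) * (a + 1), 1, Nat.mul_pos (by omega) (by omega), fun h => absurd h hper, ?_⟩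
      have h1 : Function.IsPeriodicPt G (b - a) (G^[a] z₀) := by
        change G^[b - a] (G^[a] z₀) = G^[a] z₀
        rw [← Function.iterate_add_apply, Nat.sub_add_cancel hab.le, h]
      have h2 : a ≤ (b - a) * (a + 1) * 1 := by
        have : 1 ≤ b - a := by omega
        nlinarith
      rw [eval_iter]
      have h3 := (h1.const_mul (a + 1)).apply_iterate ((b - a) * (a + 1) * 1 - a)
      rw [← Function.iterate_add_apply, Nat.sub_add_cancel h2, mul_comm (a + 1)] at h3
      exact h3
  -- replacing the iterate by a power makes a multiplier that is a root of unity equal to `1`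
  obtain ⟨r, hr, hμ⟩ : ∃ r, 1 ≤ r ∧ ∀ l, 1 ≤ l → ∑ i ∈ Finset.range l,
      ((iter g N₁).derivative.eval (G^[N₁ * k] z₀) ^ r) ^ i ≠ 0 := by
    set μ := (iter g N₁).derivative.eval (G^[N₁ * k] z₀)
    by_cases hμ : ∃ r, 1 ≤ r ∧ μ ^ r = 1
    · obtain ⟨r, hr, hr1⟩ := hμ
      refine ⟨r, hr, fun l hl => ?_⟩
      simp only [hr1, one_pow, Finset.sum_const, Finset.card_range, nsmul_eq_mul, mul_one]
      exact_mod_cast (by omega : l ≠ 0)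
    · push Not at hμ
      refine ⟨1, le_rfl, fun l hl h0 => hμ l hl ?_⟩
      rw [← sub_eq_zero, ← geom_sum_mul, ← pow_one μ]
      simp only [pow_one] at h0 ⊢
      rw [h0, zero_mul]
  have hc : G^[N₁ * r * k] z₀ = G^[N₁ * k] z₀ := by
    have hc2 := hc1
    rw [eval_iter] at hc2
    rw [show N₁ * r * k = N₁ * ((r - 1) * k) + N₁ * k by
      obtain ⟨r, rfl⟩ := Nat.exists_eq_add_of_le' hr
      simp only [Nat.add_sub_cancel]; ring, Function.iterate_add_apply, Function.iterate_mul]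
    exact Function.iterate_fixed hc2 _
  have hit : iter g (N₁ * r) = iter (iter g N₁) r := by
    refine Polynomial.funext fun t => ?_
    rw [eval_iter, eval_iter, Function.iterate_mul]
    congr 1
    ext t
    rw [eval_iter]
  refine ⟨N₁ * r, k, Nat.mul_pos hN₁ hr, hk, ?_, ?_⟩
  · rw [hc, hit, eval_iter]
    exact Function.iterate_fixed hc1 r
  · rw [hc, hit, derivative_iter_eval_of_fixed _ hc1]
    exact hμ

/-! ### Hypersurfaces of preperiodic points through a given point -/

section Hypersurfaces

variable {K : Type u} [Field K] {Λ : Scheme.{u}} {s : Λ ⟶ Spec (.of K)} {d : ℕ} {P : Γ(Λ, ⊤)[X]}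

theorem iterate_eval_fiber_iter (N : ℕ) (x : Pt s) (m : ℕ) (z : K) :
    (fun t => (fiber (iter P N) x).eval t)^[m] z = (fun t => (fiber P x).eval t)^[N * m] z := by
  rw [Function.iterate_mul]
  congr 1
  ext t
  exact eval_fiber_iter P N x t

theorem iterate_mul_eq_of_fixed {N k n : ℕ} {x : Pt s} {z c₀ : K}
    (hc₀ : (fun t => (fiber P x).eval t)^[N * k] z = c₀)
    (hfix : (fiber (iter P N) x).eval c₀ = c₀) (hkn : k ≤ n) :
    (fun t => (fiber P x).eval t)^[N * n] z = c₀ := by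
  rw [← iterate_eval_fiber_iter] at hc₀ ⊢
  rw [← Nat.sub_add_cancel hkn, Function.iterate_add_apply, hc₀]
  exact Function.iterate_fixed hfix _

/-- On an irreducible set of points with `P^b = P^a`, the image of a high iterate consists of
fixed points of `P^N`. -/
theorem subset_coincidence_of_iterate_eq {Z : Set (LinePt s)} (hZ : IsIrreducible Z)
    {p₀ : LinePt s} (hp₀ : p₀ ∈ Z) {N k : ℕ} {c₀ : K}
    (hc₀ : (fun t => (fiber P p₀.lam).eval t)^[N * k] p₀.z = c₀)
    (hfix : (fiber (iter P N) p₀.lam).eval c₀ = c₀)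
    (hsum : ∀ l, 1 ≤ l →
      ∑ i ∈ Finset.range l, (fiber (iter P N) p₀.lam).derivative.eval c₀ ^ i ≠ 0)
    {a b : ℕ} (hab : a < b) (h : Z ⊆ coincidence s P a b) {n : ℕ} (hkn : k ≤ n)
    (han : a ≤ N * n) : Z ⊆ coincidence s P (N * (n + 1)) (N * n) := by
  have key := eval_eq_self_on hZ hp₀ (iter P N) (iter P (N * n))
    (by rw [eval_fiber_iter]; exact iterate_mul_eq_of_fixed hc₀ hfix hkn) hfix hsum
    (l := b - a) (by omega) fun p hp => by
      have hper : Function.IsPeriodicPt (fun t => (fiber P p.lam).eval t) (b - a)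
          ((fun t => (fiber P p.lam).eval t)^[a] p.z) := by
        change (fun t => (fiber P p.lam).eval t)^[b - a] _ = _
        rw [← Function.iterate_add_apply, Nat.sub_add_cancel hab.le]
        exact (h hp).symm
      have := (hper.const_mul N).apply_iterate (N * n - a)
      rw [← Function.iterate_add_apply, Nat.sub_add_cancel han] at this
      rw [eval_fiber_iter, iterate_eval_fiber_iter]
      exact this
  intro p hp
  rw [mem_coincidence, ← eval_fiber_iter, ← eval_fiber_iter, mul_add, mul_one, add_comm]
  rw [← key p hp, eval_fiber_iter, eval_fiber_iter, eval_fiber_iter, Function.iterate_add_apply]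

/-- With a nonzero multiplier, cancelling iterates of `P^N` would put all the hypersurfaces into the
single locus `{P^{N(k+1)} = P^{Nk}}`, which contains only finitely many. -/
theorem derivative_eval_eq_zero [Infinite K] [LocallyOfFiniteType s] [QuasiCompact s]
    (hP : IsFamilyOfDegree s d P) (hd : 2 ≤ d)
    (Z : ℕ → TopologicalSpace.IrreducibleCloseds (LinePt s)) (hinj : Function.Injective Z)
    (hcodim : ∀ i, Order.coheight (Z i) = 1) {p₀ : LinePt s}
    (hmem : ∀ i, p₀ ∈ (Z i : Set (LinePt s))) {N k : ℕ} (hN : 1 ≤ N) {c₀ : K}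
    (hc₀ : (fun t => (fiber P p₀.lam).eval t)^[N * k] p₀.z = c₀)
    (hfix : (fiber (iter P N) p₀.lam).eval c₀ = c₀)
    (h : ∀ i, ∃ n, k ≤ n ∧ (Z i : Set (LinePt s)) ⊆ coincidence s P (N * (n + 1)) (N * n)) :
    (fiber (iter P N) p₀.lam).derivative.eval c₀ = 0 := by
  by_contra hμ
  obtain ⟨i, hi⟩ := exists_not_subset_coincidence hP hd Z hinj hcodim
    (a := N * (k + 1)) (b := N * k) (by rw [mul_add]; omega)
  obtain ⟨n, hkn, hn⟩ := h i
  refine hi fun p hp => ?_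
  have := eq_on_of_iterate_eq (Z i).isIrreducible (hmem i) (iter P N) (iter P (N * (k + 1)))
    (iter P (N * k))
    (by rw [eval_fiber_iter]; exact iterate_mul_eq_of_fixed hc₀ hfix (by omega))
    (by rw [eval_fiber_iter]; exact hc₀) hfix hμ (n - k) (fun p hp => by
      have h1 := mem_coincidence.mp (hn hp)
      rw [eval_fiber_iter, eval_fiber_iter, iterate_eval_fiber_iter, iterate_eval_fiber_iter,
        ← Function.iterate_add_apply, ← Function.iterate_add_apply, ← mul_add, ← mul_add,
        Nat.sub_add_cancel hkn, show n - k + (k + 1) = n + 1 by omega]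
      exact h1) p hp
  rwa [eval_fiber_iter, eval_fiber_iter] at this

end Hypersurfaces

/-! ### The conjugated family after base change -/

section Conjugate

variable {K : Type u} [Field K] {Λ Λ' : Scheme.{u}} {s : Λ ⟶ Spec (.of K)}

/-- The conjugate `Q(y + c) - c` of a family pulled back by `π`. -/
noncomputable def conjugate (π : Λ' ⟶ Λ) (c : Γ(Λ', ⊤)) (Q : Γ(Λ, ⊤)[X]) : Γ(Λ', ⊤)[X] :=
  (Q.map π.appTop.hom).comp (X + C c) - C c

variable (π : Λ' ⟶ Λ) (c : Γ(Λ', ⊤)) (Q : Γ(Λ, ⊤)[X])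

theorem conjugate_comp_affine : (conjugate π c Q).comp (affine 1 (-c)) =
    (affine 1 (-c)).comp (Q.map π.appTop.hom) := by
  simp [conjugate, affine, comp_assoc, sub_eq_add_neg]

theorem eval_fiber_affine (x : Pt (π ≫ s)) (z : K) :
    (fiber (affine 1 (-c)) x).eval z = z - x.value c := by
  simp [fiber, affine, sub_eq_add_neg]

theorem fiber_conjugate (x : Pt (π ≫ s)) : fiber (conjugate π c Q) x =
    (fiber Q (x.map s π)).comp (X + C (x.value c)) - C (x.value c) := by
  rw [← fiber_map, fiber, conjugate, Polynomial.map_sub, map_comp, Polynomial.map_add,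
    Polynomial.map_X, Polynomial.map_C]
  rfl

theorem eval_fiber_conjugate (x : Pt (π ≫ s)) (y : K) : (fiber (conjugate π c Q) x).eval y =
    (fiber Q (x.map s π)).eval (y + x.value c) - x.value c := by
  rw [fiber_conjugate]
  simp [eval_comp]

theorem iterate_eval_fiber_conjugate (x : Pt (π ≫ s)) (n : ℕ) (y : K) :
    (fun t => (fiber (conjugate π c Q) x).eval t)^[n] y =
      (fun t => (fiber Q (x.map s π)).eval t)^[n] (y + x.value c) - x.value c := by
  rw [eq_sub_iff_add_eq]
  refine Function.Semiconj.iterate_right (f := fun y => y + x.value c) (fun y => ?_) n y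
  change (fiber (conjugate π c Q) x).eval y + _ = _
  rw [eval_fiber_conjugate, sub_add_cancel]

theorem transform_eq_preimage (Z : Set (LinePt s)) :
    transform s π (affine 1 (-c)) Z = shift s π c ⁻¹' Z := by
  ext p
  simp only [transform, eval_fiber_affine, Set.mem_ofPred_eq, Set.mem_preimage, shift]
  constructor
  · rintro ⟨z, hz, h⟩
    rwa [h, sub_add_cancel]
  · exact fun h => ⟨_, h, by ring⟩

variable {P : Γ(Λ, ⊤)[X]} {N : ℕ} {π c}

theorem mem_preimageLocus_conjugate {n : ℕ} {p : LinePt (π ≫ s)} :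
    p ∈ preimageLocus (π ≫ s) (conjugate π c (iter P N)) n 0 ↔
      (fun t => (fiber P (shift s π c p).lam).eval t)^[N * n] (shift s π c p).z =
        p.lam.value c := by
  change (fun t => (fiber (conjugate π c (iter P N)) p.lam).eval t)^[n] p.z = 0 ↔ _
  rw [iterate_eval_fiber_conjugate, iterate_eval_fiber_iter, sub_eq_zero]
  rfl

theorem shift_mem_coincidence
    (hc : ∀ x : Pt (π ≫ s), (fiber (iter P N) (x.map s π)).eval (x.value c) = x.value c)
    {n : ℕ} {p : LinePt (π ≫ s)}
    (hp : p ∈ preimageLocus (π ≫ s) (conjugate π c (iter P N)) n 0) :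
    shift s π c p ∈ coincidence s P (N * (n + 1)) (N * n) := by
  rw [mem_preimageLocus_conjugate] at hp
  rw [mem_coincidence, mul_add, mul_one, add_comm, Function.iterate_add_apply, hp,
    ← eval_fiber_iter]
  exact hc p.lam

/-- By the uniqueness of the fixed point near a super-attracting fixed point, the fixed points of
`R` in the image of `R^n` are all zero on an irreducible set. -/
theorem subset_preimageLocus
    (hc : ∀ x : Pt (π ≫ s), (fiber (iter P N) (x.map s π)).eval (x.value c) = x.value c)
    {Z' : Set (LinePt (π ≫ s))} (hZ' : IsIrreducible Z') {p₀ : LinePt (π ≫ s)} (hp₀ : p₀ ∈ Z')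
    (hμ : (fiber (conjugate π c (iter P N)) p₀.lam).derivative.eval 0 ≠ 1) {n : ℕ}
    (h : shift s π c '' Z' ⊆ coincidence s P (N * (n + 1)) (N * n))
    (hn : p₀ ∈ preimageLocus (π ≫ s) (conjugate π c (iter P N)) n 0) :
    Z' ⊆ preimageLocus (π ≫ s) (conjugate π c (iter P N)) n 0 := by
  have hR0 : ∀ x : Pt (π ≫ s), (fiber (conjugate π c (iter P N)) x).eval 0 = 0 := fun x => by
    rw [eval_fiber_conjugate, zero_add, hc, sub_self]
  have hz : ∀ p : LinePt (π ≫ s), (fiber (0 : Γ(Λ', ⊤)[X]) p.lam).eval p.z = 0 := fun p => by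
    simp [fiber]
  intro p hp
  have := eq_on_of_eval_eq_self hZ' hp₀ (conjugate π c (iter P N))
    (iter (conjugate π c (iter P N)) n) 0 (c₀ := 0)
    (by rw [eval_fiber_iter]; exact hn) (hz _) (hR0 _) hμ (fun p hp => by
      have h1 := mem_coincidence.mp (h ⟨p, hp, rfl⟩)
      rw [eval_fiber_iter, iterate_eval_fiber_conjugate, iterate_eval_fiber_iter,
        eval_fiber_conjugate, sub_add_cancel, eval_fiber_iter, ← Function.iterate_add_apply,
        add_comm N, ← mul_add_one]
      exact congrArg (· - _) h1)
    (fun p _ => by rw [hz, hR0]) p hp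
  rwa [hz, eval_fiber_iter] at this

variable [LocallyOfFiniteType s] [QuasiCompact s] [IsAlgClosed K] [LocallyOfFiniteType π]
  [QuasiCompact π] [UniversallyOpen π]

/-- A relation on a component of the transform of `Z` descends to `Z`, which that component
dominates. -/
theorem subset_coincidence_of_isComponentOf
    (hc : ∀ x : Pt (π ≫ s), (fiber (iter P N) (x.map s π)).eval (x.value c) = x.value c)
    {Z : Set (LinePt s)} (hZ : IsIrreducible Z) (hZc : IsClosed Z) {Z' : Set (LinePt (π ≫ s))}
    (hZ' : IsComponentOf (shift s π c ⁻¹' Z) Z') {n : ℕ}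
    (h : Z' ⊆ preimageLocus (π ≫ s) (conjugate π c (iter P N)) n 0) :
    Z ⊆ coincidence s P (N * (n + 1)) (N * n) := by
  refine (subset_closure_image_of_isComponentOf (continuous_shift π c) (isOpenMap_shift π c) hZ
    hZc hZ').trans ((isClosed_coincidence P _ _).closure_subset_iff.mpr ?_)
  rintro _ ⟨p, hp, rfl⟩
  exact shift_mem_coincidence hc (h hp)

/-- A component of the transform of a component of `{P^{N(n+1)} = P^{Nn}}` is a component of
`{R^n = 0}` as soon as it is contained in it. -/
theorem isComponentOf_preimageLocus
    (hc : ∀ x : Pt (π ≫ s), (fiber (iter P N) (x.map s π)).eval (x.value c) = x.value c)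
    {Z : Set (LinePt s)} {n : ℕ} (hZ : IsComponentOf (coincidence s P (N * (n + 1)) (N * n)) Z)
    {Z' : Set (LinePt (π ≫ s))} (hZ' : IsComponentOf (shift s π c ⁻¹' Z) Z')
    (h : Z' ⊆ preimageLocus (π ≫ s) (conjugate π c (iter P N)) n 0) :
    IsComponentOf (preimageLocus (π ≫ s) (conjugate π c (iter P N)) n 0) Z' := by
  have hS := isClosed_coincidence (s := s) P (N * (n + 1)) (N * n)
  refine ⟨⟨hZ'.prop.1, h⟩, fun Y hY hZY => ?_⟩
  have h1 : Z ⊆ closure (shift s π c '' Y) :=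
    (subset_closure_image_of_isComponentOf (continuous_shift π c) (isOpenMap_shift π c)
      hZ.prop.1 (IsComponentOf.isClosed hS hZ) hZ').trans (closure_mono (Set.image_mono hZY))
  have h2 : Z = closure (shift s π c '' Y) :=
    IsComponentOf.eq_of_subset hZ (hY.1.image _ (continuous_shift π c).continuousOn).closure
      (hS.closure_subset_iff.mpr (by
        rintro _ ⟨p, hp, rfl⟩
        exact shift_mem_coincidence hc (hY.2 hp))) h1
  have h3 : Y ⊆ shift s π c ⁻¹' Z := fun p hp => by
    rw [Set.mem_preimage, h2]
    exact subset_closure ⟨p, hp, rfl⟩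
  exact (IsComponentOf.eq_of_subset hZ' hY.1 h3 hZY).ge

end Conjugate

/-! ### Local degrees -/

theorem localDegree_zero {K : Type*} [Field K] {p : K[X]} (h : p.eval 0 = 0) :
    localDegree p 0 = p.natTrailingDegree := by
  rw [localDegree, h, C_0, sub_zero, rootMultiplicity_eq_natTrailingDegree']

section LocalDegree

variable {K : Type u} [Field K] [IsAlgClosed K] {Λ Λ' : Scheme.{u}} {s : Λ ⟶ Spec (.of K)}
  [LocallyOfFiniteType s] [QuasiCompact s] {π : Λ' ⟶ Λ}
  [LocallyOfFiniteType π] [QuasiCompact π] [UniversallyOpen π] {d : ℕ} {P : Γ(Λ, ⊤)[X]} {N : ℕ}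
  {c : Γ(Λ', ⊤)}

/-- If the local degree at `0` of the conjugated family `R` were locally constant, then on all the
hypersurfaces `R^k` would already be zero, for one and the same `k`; this is possible only on
finitely many hypersurfaces. -/
theorem not_eventually_localDegree_eq (hP : IsFamilyOfDegree s d P) (hd : 2 ≤ d)
    (hc : ∀ x : Pt (π ≫ s), (fiber (iter P N) (x.map s π)).eval (x.value c) = x.value c)
    (Z : ℕ → TopologicalSpace.IrreducibleCloseds (LinePt s)) (hinj : Function.Injective Z)
    (hcodim : ∀ i, Order.coheight (Z i) = 1) (hN : 1 ≤ N) {k : ℕ} {p₀ : LinePt (π ≫ s)}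
    (hmem : ∀ i, shift s π c p₀ ∈ (Z i : Set (LinePt s)))
    (hp₀ : p₀ ∈ preimageLocus (π ≫ s) (conjugate π c (iter P N)) k 0)
    (h : ∀ i, ∃ n, k ≤ n ∧ ∀ Z', IsComponentOf (shift s π c ⁻¹' (Z i : Set (LinePt s))) Z' →
      p₀ ∈ Z' → Z' ⊆ preimageLocus (π ≫ s) (conjugate π c (iter P N)) n 0) :
    ¬ ∀ᶠ x in nhds p₀.lam, localDegree (fiber (conjugate π c (iter P N)) x) 0 =
      localDegree (fiber (conjugate π c (iter P N)) p₀.lam) 0 := by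
  set R := conjugate π c (iter P N) with hR
  have hR0 : ∀ x : Pt (π ≫ s), (fiber R x).eval 0 = 0 := fun x => by
    rw [eval_fiber_conjugate, zero_add, hc, sub_self]
  have hRne : fiber R p₀.lam ≠ 0 := fun h0 => by
    rw [fiber_conjugate, sub_eq_zero] at h0
    have h1 := congrArg natDegree h0
    rw [natDegree_C, natDegree_comp, natDegree_X_add_C, mul_one, fiber_iter, natDegree_iter,
      hP.natDegree_fiber] at h1
    exact pow_ne_zero N (by omega) h1
  intro hev
  obtain ⟨U, hU, hUo, hpU⟩ := eventually_nhds_iff.mp hev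
  simp only [localDegree_zero (hR0 _)] at hU
  set e := (fiber R p₀.lam).natTrailingDegree
  have hecoeff : (fiber R p₀.lam).coeff e ≠ 0 := trailingCoeff_nonzero_iff_nonzero.mpr hRne
  have he : 1 ≤ e := Nat.one_le_iff_ne_zero.mpr fun h0 => hecoeff (by
    rw [h0, coeff_zero_eq_eval_zero, hR0])
  obtain ⟨i, hi⟩ := exists_not_subset_coincidence hP hd Z hinj hcodim
    (a := N * (k + 1)) (b := N * k) (by rw [mul_add]; omega)
  obtain ⟨n, hkn, hn⟩ := h i
  obtain ⟨Z', hZ', hpZ'⟩ := exists_isComponentOf_mem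
    (show p₀ ∈ shift s π c ⁻¹' (Z i : Set (LinePt s)) from hmem i)
  refine hi (subset_coincidence_of_isComponentOf hc (Z i).isIrreducible (Z i).isClosed hZ' ?_)
  intro p hp
  have := eq_zero_on_of_iterate_eq_zero hZ'.prop.1 hpZ' R (iter R k)
    (by rw [eval_fiber_iter]; exact hp₀) he (fun j hj => ?_) hecoeff (n - k) (fun p hp => by
      rw [eval_fiber_iter, ← Function.iterate_add_apply, Nat.sub_add_cancel hkn]
      exact hn Z' hZ' hpZ' hp) p hp
  · rwa [eval_fiber_iter] at this
  -- the coefficients below the local degree vanish over `U`, hence on all of `Z'`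
  · have := mem_vanishing_of_inter hZ'.prop.1 (hUo.preimage LinePt.continuous_lam)
      ⟨p₀, hpZ', hpU⟩ (G := C (R.coeff j)) fun p hp => by
        have := coeff_eq_zero_of_lt_natTrailingDegree (hj.trans_eq (hU p.lam hp.2).symm)
        rw [fiber, Polynomial.map_C, eval_C]
        rwa [fiber, Polynomial.coeff_map] at this
    intro p hp
    have := mem_vanishing.mp this p hp
    rw [fiber, Polynomial.map_C, eval_C] at this
    rwa [fiber, Polynomial.coeff_map]

end LocalDegree

end PolyFamily

open PolyFamily in
theorem mainTheorem12 {K : Type u} [Field K] [IsAlgClosed K] [CharZero K]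
    {Λ : Scheme.{u}} (s : Λ ⟶ Spec (.of K))
    [IsReduced Λ] [IsSeparated s] [LocallyOfFiniteType s] [QuasiCompact s]
    (d : ℕ) (hd : 2 ≤ d) (P : Γ(Λ, ⊤)[X]) (hP : IsFamilyOfDegree s d P)
    (lam₀ : Pt s) (z₀ : K)
    (Z : ℕ → TopologicalSpace.IrreducibleCloseds (LinePt s))
    (hinj : Function.Injective Z)
    (hcodim : ∀ i, Order.coheight (Z i) = 1)
    (hpreper : ∀ i, (Z i : Set (LinePt s)) ⊆ preper s P)
    (hmem : ∀ i, (⟨lam₀, z₀⟩ : LinePt s) ∈ (Z i : Set (LinePt s))) :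
    -- a base change
    ∃ (Λ' : Scheme.{u}) (π : Λ' ⟶ Λ) (lam₀' : Pt (π ≫ s)),
      IsReduced Λ' ∧ IsFinite π ∧ Surjective π ∧
      (∀ T ∈ irreducibleComponents Λ', π '' T ∈ irreducibleComponents Λ) ∧
      lam₀'.map s π = lam₀ ∧
    -- an iterate, a family of affine maps, and the conjugated family
    ∃ (N k : ℕ) (a : Γ(Λ', ⊤)ˣ) (b : Γ(Λ', ⊤)) (R : Γ(Λ', ⊤)[X]) (c : K),
      1 ≤ N ∧
      R.comp (affine a b) = (affine a b).comp ((iter P N).map π.appTop.hom) ∧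
      -- the point `c` is the image of a point of the orbit of `z₀`, of `z₀` itself if periodic
      c = (fiber (affine a b) lam₀').eval ((fun t => (fiber P lam₀).eval t)^[N * k] z₀) ∧
      (z₀ ∈ Function.periodicPts (fun t => (fiber P lam₀).eval t) → k = 0) ∧
      -- persistent fixed point, super-attracting at `lam₀'`, local degree not locally constant
      (∀ x : Pt (π ≫ s), (fiber R x).eval c = c) ∧
      (fiber R lam₀').derivative.eval c = 0 ∧
      (¬ ∀ᶠ x in nhds lam₀', localDegree (fiber R x) c = localDegree (fiber R lam₀') c) ∧
      -- the hypersurfaces are components of `{R^{n i} = c}`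
      ∃ n : ℕ → ℕ, Filter.Tendsto n Filter.atTop Filter.atTop ∧
        ∀ i, ∀ Z' : Set (LinePt (π ≫ s)),
          IsComponentOf (transform s π (affine a b) (Z i)) Z' →
          (⟨lam₀', (fiber (affine a b) lam₀').eval z₀⟩ : LinePt (π ≫ s)) ∈ Z' →
          IsComponentOf (preimageLocus (π ≫ s) R (n i) c) Z' := by
  have hdeg := hP.natDegree_eq lam₀
  -- `P^(A i) = P^(B i)` on the hypersurface `Z i`
  choose A B hAB hZAB using fun i => exists_iterate_eq_of_subset_preper s P (by omega)
    (hP.isUnit_leadingCoeff lam₀) (Z i) (hpreper i)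
  have h0 := hZAB 0 _ (hmem 0)
  dsimp only at h0
  obtain ⟨N, k, hN, hk, hfix, hsum⟩ := exists_iterate_sum_pow_ne_zero (fiber P lam₀) z₀ (hAB 0)
    h0
  obtain ⟨c₀, hc₀⟩ : ∃ c₀, (fun t => (fiber P lam₀).eval t)^[N * k] z₀ = c₀ := ⟨_, rfl⟩
  rw [hc₀, ← fiber_iter] at hfix hsum
  have hcoin : ∀ i n, k ≤ n → A i ≤ n →
      (Z i : Set (LinePt s)) ⊆ coincidence s P (N * (n + 1)) (N * n) := fun i n hkn hAn =>
    subset_coincidence_of_iterate_eq (Z i).isIrreducible (hmem i) hc₀ hfix hsum (hAB i)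
      (hZAB i) hkn (hAn.trans (Nat.le_mul_of_pos_left n hN))
  have hμ := derivative_eval_eq_zero hP hd Z hinj hcodim hmem hN hc₀ hfix fun i =>
    ⟨k + A i, by omega, hcoin i _ (by omega) (by omega)⟩
  -- the base change making the fixed point `c₀` a regular function of the parameter
  have hF := hP.iter_sub_X hd hN
  obtain ⟨u, hu⟩ := hF.isUnit_leadingCoeff lam₀
  have hFmonic : (C (↑u⁻¹ : Γ(Λ, ⊤)) * (iter P N - X)).Monic := by
    refine monic_C_mul_of_mul_leadingCoeff_eq_one ?_
    rw [← hu, Units.inv_mul]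
  obtain ⟨Λ', π, lam₀', c, hred, hfin, hsurj, hopen, hlam, hcval, hroot⟩ :=
    exists_baseChange_of_monic s _ hFmonic lam₀ c₀ (by
      rw [fiber, Polynomial.map_mul, Polynomial.map_sub, eval_mul, eval_sub, Polynomial.map_X,
        eval_X]
      exact mul_eq_zero_of_right _ (sub_eq_zero.mpr hfix))
  have hc : ∀ x : Pt (π ≫ s),
      (fiber (iter P N) (x.map s π)).eval (x.value c) = x.value c := fun x => by
    rw [eval₂_mul, eval₂_C, eval₂_sub, eval₂_X] at hroot
    have h1 := (((u⁻¹).isUnit.map π.appTop.hom).mul_right_eq_zero).mp hroot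
    have h2 := congrArg x.value h1
    rw [map_sub, map_zero, sub_eq_zero, hom_eval₂] at h2
    rw [← fiber_map, fiber, Polynomial.map_map, Polynomial.eval_map]
    exact h2
  have hnoeth := isNoetherian_of_finiteType (π ≫ s)
  have hshift : shift s π c ⟨lam₀', z₀ - c₀⟩ = ⟨lam₀, z₀⟩ := by
    rw [shift, hlam, hcval, sub_add_cancel]
  have hbase : ∀ n, k ≤ n → (⟨lam₀', z₀ - c₀⟩ : LinePt (π ≫ s)) ∈
      preimageLocus (π ≫ s) (conjugate π c (iter P N)) n 0 := fun n hkn => by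
    rw [mem_preimageLocus_conjugate, hshift, hcval]
    exact iterate_mul_eq_of_fixed hc₀ hfix hkn
  have hder : (fiber (conjugate π c (iter P N)) lam₀').derivative.eval 0 = 0 := by
    rw [fiber_conjugate, hlam, hcval]
    simpa [derivative_comp, eval_comp] using hμ
  have hzero : ∀ i n, k ≤ n → A i ≤ n → ∀ Z',
      IsComponentOf (shift s π c ⁻¹' (Z i : Set (LinePt s))) Z' →
      (⟨lam₀', z₀ - c₀⟩ : LinePt (π ≫ s)) ∈ Z' →
      Z' ⊆ preimageLocus (π ≫ s) (conjugate π c (iter P N)) n 0 :=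
    fun i n hkn hAn Z' hZ' hpZ' => subset_preimageLocus hc hZ'.prop.1 hpZ'
      (by rw [hder]; exact zero_ne_one)
      ((Set.image_subset_iff.mpr hZ'.prop.2).trans (hcoin i n hkn hAn)) (hbase n hkn)
  -- `n i = k + A i + i` is large enough for `hzero`; the summand `i` makes it tend to infinity
  refine ⟨Λ', π, lam₀', hred, hfin, hsurj, fun T hT =>
    image_mem_irreducibleComponents π.continuous π.isOpenMap π.isClosedMap hT, hlam, N, k, 1, -c,
    conjugate π c (iter P N), 0, hN, conjugate_comp_affine π c _, ?_, hk, fun x => ?_, hder, ?_,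
    fun i => k + A i + i, Filter.tendsto_atTop_mono (fun i => Nat.le_add_left i _)
      Filter.tendsto_id, fun i Z' hZ' hpZ' => ?_⟩
  · rw [eval_fiber_affine, hc₀, hcval, sub_self]
  · rw [eval_fiber_conjugate, zero_add, hc, sub_self]
  · exact not_eventually_localDegree_eq hP hd hc Z hinj hcodim hN (p₀ := ⟨lam₀', z₀ - c₀⟩)
      (fun i => by rw [hshift]; exact hmem i) (hbase k le_rfl) fun i =>
        ⟨k + A i, by omega, hzero i _ (by omega) (by omega)⟩
  · rw [transform_eq_preimage] at hZ'
    rw [eval_fiber_affine, hcval] at hpZ'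
    have hkn : k ≤ k + A i + i := by omega
    have hAn : A i ≤ k + A i + i := by omega
    exact isComponentOf_preimageLocus hc
      (isComponentOf_of_coheight_eq_one (Z i) (hcodim i) (isClosed_coincidence P _ _)
        (interior_coincidence hP hd (by rw [mul_add]; omega))
        (hcoin i _ hkn hAn)) hZ' (hzero i _ hkn hAn Z' hZ' hpZ')
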